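/- **Setting.** Let $\Omega=C_0(\mathbb R_+,\mathbb R^d)$ be the space of continuous paths started at $0$, with the topology of locally uniform convergence, its Borel $\sigma$-field $\mathcal F$, the raw filtration $\mathbb F=(\mathcal F_t)$ generated by the canonical process, and the universally completed filtration $\mathbb F^*=(\mathcal F^*_t)$. Stopping times are $\mathbb F$-stopping times. For $\omega,\tilde\omega\in\Omega$ let $\omega\otimes_s\tilde\omega$ be the path equal to $\omega$ on $[0,s]$ and to $\omega_s+\tilde\omega_{\cdot-s}$ on $[s,\infty)$; for a finite stopping time $\theta$ and a probability $P$, let $P^{\theta,\omega}$ be the conditional law under $P$, given $\mathcal F_\theta$, of the path $\omega'_{\theta+\cdot}-\omega'_{\theta}$. Let $\mathcal Q(s,\omega)$, $(s,\omega)\in\mathbb R_+\times\Omega$, be sets of probability measures on $\Omega$, depending on $\omega$ only through $\omega|_{[0,s]}$, such that for all $(s,\bar\omega)$, all finite stopping times $\sigma\ge s$ and all $P\in\mathcal Q(s,\bar\omega)$, with $\theta(\omega):=\sigma(\bar\omega\otimes_s\omega)-s$ and $\mathcal Q(\sigma,\omega):=\mathcal Q(\sigma(\omega),\omega)$: (a)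 $\{(P',\omega):P'\in\mathcal Q(\sigma,\omega)\}$ is analytic; (b) $P^{\theta,\omega}\in\mathcal Q(\sigma,\bar\omega\otimes_s\omega)$ for $P$-a.e. $\omega$; (c) if $\nu$ is an $\mathcal F_\theta$-measurable kernel with $\nu(\omega)\in\mathcal Q(\sigma,\bar\omega\otimes_s\omega)$ for $P$-a.e. $\omega$, then the measure $A\mapsto\iint \mathbf 1_A(\omega\otimes_{\theta(\omega)}\omega')\,\nu(d\omega';\omega)\,P(d\omega)$ belongs to $\mathcal Q(s,\bar\omega)$. Put $\mathcal Q:=\mathcal Q(0,\cdot)$ and $\mathcal Q(\sigma,Q):=\{Q'\in\mathcal Q: Q'=Q\text{ on }\mathcal F_\sigma\}$. "q.s." means $Q$-a.s. for every $Q\in\mathcal Q$. **Market.** $S$ is a real-valued, $\mathbb F^*$-adapted, right-continuous process, q.s. nonnegative and q.s. continuous; the maturity $\tau>0$ q.s. is a stopping time with values in $[0,\infty]$; and the wealth process $W_t=S_t\mathbf 1_{\{t<\tau\}}+S_\tau\mathbf 1_{\{\tau\le t\}}$ is a $Q$-local martingale for every $Q\in\mathcal Q$. A robust fundamental value is a process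 $S^*$ such that for every finite stopping time $\sigma$ and every $Q\in\mathcal Q$ $$S^*_\sigma=\Big(\operatorname*{ess\,sup}_{Q'\in\mathcal Q(\sigma,Q)}E_{Q'}[S_\tau\mathbf 1_{\{\tau<\infty\}}\mid\mathcal F_\sigma]\Big)\mathbf 1_{\{\sigma<\tau\}}\qquad Q\text{-a.s.}$$ Put $W^*_t=S^*_t+S_\tau\mathbf 1_{\{\tau\le t\}}$ and $\beta=W-W^*$ (so $\beta_t=S_t-S^*_t$ for $t<\tau$). There is a robust bubble if $Q(\beta_\sigma>0)>0$ for some finite stopping time $\sigma$ and some $Q\in\mathcal Q$. A $\mathbb F^*$-adapted process $X$ is a $\mathcal Q$-martingale if each $X_t$ is $Q$-integrable for every $Q\in\mathcal Q$, $\sup_{Q\in\mathcal Q}E_Q[X_t]<\infty$, and for all $t\le T$ and $Q\in\mathcal Q$, $X_t=\operatorname{ess\,sup}_{Q'\in\mathcal Q(t,Q)}E_{Q'}[X_T\mid\mathcal F_t]$ $Q$-a.s.; it is a $\mathcal Q$-symmetric martingale if $X$ and $-X$ are both $\mathcal Q$-martingales. **Proposition.** Let $S^*$ be a robust fundamental value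 (in (i) and (ii)). (i) If there are $\bar Q\in\mathcal Q$ and $t\ge0$ such that $Q'(\tau=\infty)=1$ for all $Q'\in\mathcal Q(t,\bar Q)$, and the price $S_t$ is not $\bar Q$-a.s. zero (which is automatic if $S$ is strictly positive before maturity), then there is a robust bubble. (ii) The bubble $\beta$ is a $Q$-local submartingale for every $Q\in\mathcal Q$. (iii) The wealth process can be a $\mathcal Q$-symmetric martingale in the presence of a bubble: for every $d$, families $\mathcal Q(\cdot,\cdot)$ as above with $\mathcal Q\ne\emptyset$ exist, and for each of them the fiat money market $S\equiv1$, $\tau\equiv\infty$ is a market as above that has a robust fundamental value and a robust bubble, while $W$ is a $\mathcal Q$-symmetric martingale. -/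

import Mathlib

open MeasureTheory ProbabilityTheory Filter Topology
open scoped NNReal ENNReal

noncomputable section

namespace RobustBubbles

/-! ### The canonical path space -/

/-- `Ω = C₀(ℝ₊, ℝᵈ)`: continuous paths started at `0`. -/
def PathSpace (d : ℕ) : Type :=
  {ω : C(ℝ≥0, EuclideanSpace ℝ (Fin d)) // ω 0 = 0}

variable {d : ℕ}

/-- The topology of locally uniform convergence (the compact-open topology). -/
instance : TopologicalSpace (PathSpace d) :=
  inferInstanceAs (TopologicalSpace {ω : C(ℝ≥0, EuclideanSpace ℝ (Fin d)) // ω 0 = 0})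

instance : MeasurableSpace (PathSpace d) := borel _

instance : BorelSpace (PathSpace d) := ⟨rfl⟩

instance : CoeFun (PathSpace d) (fun _ => ℝ≥0 → EuclideanSpace ℝ (Fin d)) := ⟨fun ω => ω.1⟩

theorem continuous_eval (u : ℝ≥0) : Continuous (fun ω : PathSpace d => ω u) :=
  (ContinuousEvalConst.continuous_eval_const u).comp continuous_subtype_val

/-- The (raw) filtration `𝔽` generated by the canonical process. -/
def canonFiltration (d : ℕ) : Filtration ℝ≥0 (inferInstance : MeasurableSpace (PathSpace d)) :=
  Filtration.natural (fun (u : ℝ≥0) (ω : PathSpace d) => ω u)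
    (fun u => (continuous_eval u).stronglyMeasurable)

/-- `σ : Ω → [0, ∞)` is a finite stopping time of `𝔽`. -/
abbrev IsFiniteStoppingTime (σ : PathSpace d → ℝ≥0) : Prop :=
  IsStoppingTime (canonFiltration d) (fun ω => (σ ω : WithTop ℝ≥0))

/-- The concatenation `ω ⊗ₛ ω'`: equal to `ω u` for `u ≤ s` and to `ω s + ω' (u - s)` for `u ≥ s`
(the subtraction of `ℝ≥0` is truncated and `ω' 0 = 0`). -/
def concat (s : ℝ≥0) (ω ω' : PathSpace d) : PathSpace d :=
  ⟨⟨fun u => ω (min u s) + ω' (u - s), by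
      have h1 : Continuous fun u : ℝ≥0 => ω.1 (min u s) := by fun_prop
      have h2 : Continuous fun u : ℝ≥0 => ω'.1 (u - s) :=
        ω'.1.continuous.comp (continuous_id.sub continuous_const)
      exact h1.add h2⟩, by
    change ω.1 (min 0 s) + ω'.1 (0 - s) = 0
    simp [ω.2, ω'.2]⟩

/-- The increments of `ω` after time `s`: the path `u ↦ ω (s + u) - ω s`. -/
def shift (s : ℝ≥0) (ω : PathSpace d) : PathSpace d :=
  ⟨⟨fun u => ω (s + u) - ω s, by
      have h1 : Continuous fun u : ℝ≥0 => ω.1 (s + u) := by fun_prop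
      exact h1.sub continuous_const⟩, by
    change ω.1 (s + 0) - ω.1 s = 0
    simp⟩

/-- The universal completion of a `σ`-algebra `m`: the sets that are measurable for the completion
of `m` under every probability measure on `m`. -/
@[reducible] def universalCompletion {Ω : Type*} (m : MeasurableSpace Ω) : MeasurableSpace Ω where
  MeasurableSet' A := ∀ P : @Measure Ω m, IsProbabilityMeasure P → @NullMeasurableSet Ω m A P
  measurableSet_empty := fun _ _ => nullMeasurableSet_empty
  measurableSet_compl := fun _ h P hP => (h P hP).compl
  measurableSet_iUnion := fun _ h P hP => NullMeasurableSet.iUnion fun i => h i P hP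

/-! ### The family of priors -/

/-- The random time `θ = τ^{s,ω̄} - s`, i.e. `θ(ω) = τ(ω̄ ⊗ₛ ω) - s`. -/
def shiftedTime (τ : PathSpace d → ℝ≥0) (s : ℝ≥0) (ωbar : PathSpace d) : PathSpace d → ℝ≥0 :=
  fun ω => τ (concat s ωbar ω) - s

theorem measurable_concat (s t : ℝ≥0) (ωbar : PathSpace d) :
    Measurable[canonFiltration d t, canonFiltration d (s + t)] (concat s ωbar) := by
  have hcod : (canonFiltration d (s + t) : MeasurableSpace (PathSpace d)) =
      ⨆ j ≤ s + t, MeasurableSpace.comap (fun ω : PathSpace d => ω j) inferInstance := rfl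
  have hdom : (canonFiltration d t : MeasurableSpace (PathSpace d)) =
      ⨆ j ≤ t, MeasurableSpace.comap (fun ω : PathSpace d => ω j) inferInstance := rfl
  rw [hcod]
  refine measurable_iff_comap_le.2 ?_
  rw [MeasurableSpace.comap_iSup]
  refine iSup_le fun j => ?_
  rw [MeasurableSpace.comap_iSup]
  refine iSup_le fun hj => ?_
  rw [MeasurableSpace.comap_comp]
  refine measurable_iff_comap_le.1 ?_
  have h1 : Measurable[canonFiltration d t] (fun ω : PathSpace d => ω (j - s)) := by
    refine measurable_iff_comap_le.2 ?_
    rw [hdom]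
    exact le_iSup₂_of_le (j - s) (tsub_le_iff_left.2 hj) le_rfl
  exact h1.const_add (ωbar (min j s))

/-- The shifted time of a stopping time `τ ≥ s` is a stopping time. -/
theorem isFiniteStoppingTime_shiftedTime {τ : PathSpace d → ℝ≥0} (hτ : IsFiniteStoppingTime τ)
    (s : ℝ≥0) (ωbar : PathSpace d) :
    IsFiniteStoppingTime (shiftedTime τ s ωbar) := by
  intro t
  have h := measurable_concat s t ωbar (hτ (s + t))
  convert h using 1
  ext ω
  simp only [shiftedTime, Set.mem_ofPred_eq, Set.mem_preimage]
  norm_cast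
  exact tsub_le_iff_left

/-- `κ` is a version of `ω ↦ P^{θ,ω}`: the conditional law, given `𝓕_θ`, of the increments of
the canonical process after the stopping time `θ`. (The regular conditional probability
distribution of `P` given `𝓕_θ` at `ω` is carried by the paths that coincide with `ω` on
`[0, θ(ω)]`, and `P^{θ,ω}` is its image under `ω' ↦ ω'_{θ + ·} - ω'_θ`.) -/
structure IsShiftedRCPD (P : ProbabilityMeasure (PathSpace d)) {θ : PathSpace d → ℝ≥0}
    (hθ : IsFiniteStoppingTime θ) (κ : PathSpace d → ProbabilityMeasure (PathSpace d)) : Prop where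
  measurable : ∀ B, MeasurableSet B →
    Measurable[hθ.measurableSpace] fun ω => (κ ω : Measure (PathSpace d)) B
  cond : ∀ A B, MeasurableSet[hθ.measurableSpace] A → MeasurableSet B →
    (P : Measure (PathSpace d)) (A ∩ {ω | shift (θ ω) ω ∈ B}) =
      ∫⁻ ω in A, (κ ω : Measure (PathSpace d)) B ∂(P : Measure (PathSpace d))

/-- A family `𝒬(s, ω)` of sets of probability measures on the path space, depending on `ω` only
through `ω|_{[0,s]}`, which is measurable, invariant and stable under pasting. -/
structure PriorFamily (d : ℕ) where
  /-- the sets `𝒬(s, ω)` -/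
  sets : ℝ≥0 → PathSpace d → Set (ProbabilityMeasure (PathSpace d))
  nonanticipative : ∀ (s : ℝ≥0) (ω ω' : PathSpace d), (∀ u ≤ s, ω u = ω' u) →
    sets s ω = sets s ω'
  /-- measurability: the graph of `ω ↦ 𝒬(τ(ω), ω)` is analytic -/
  analytic_graph : ∀ τ : PathSpace d → ℝ≥0, IsFiniteStoppingTime τ →
    AnalyticSet {p : ProbabilityMeasure (PathSpace d) × PathSpace d | p.1 ∈ sets (τ p.2) p.2}
  /-- invariance: `P^{θ,ω} ∈ 𝒬(τ, ω̄ ⊗ₛ ω)` for `P`-a.e. `ω` -/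
  invariance : ∀ (s : ℝ≥0) (ωbar : PathSpace d) (τ : PathSpace d → ℝ≥0)
    (hτ : IsFiniteStoppingTime τ), (∀ ω, s ≤ τ ω) → ∀ P ∈ sets s ωbar,
    ∃ κ : PathSpace d → ProbabilityMeasure (PathSpace d),
      IsShiftedRCPD P (isFiniteStoppingTime_shiftedTime hτ s ωbar) κ ∧
      ∀ᵐ ω ∂(P : Measure (PathSpace d)),
        κ ω ∈ sets (τ (concat s ωbar ω)) (concat s ωbar ω)
  /-- stability under pasting: `P̄(A) = ∫∫ (1_A)^{θ,ω}(ω') ν(dω'; ω) P(dω)` belongs to `𝒬(s, ω̄)` -/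
  pasting : ∀ (s : ℝ≥0) (ωbar : PathSpace d) (τ : PathSpace d → ℝ≥0)
    (hτ : IsFiniteStoppingTime τ), (∀ ω, s ≤ τ ω) → ∀ P ∈ sets s ωbar,
    ∀ ν : PathSpace d → ProbabilityMeasure (PathSpace d),
      (∀ B, MeasurableSet B →
        Measurable[(isFiniteStoppingTime_shiftedTime hτ s ωbar).measurableSpace]
          fun ω => (ν ω : Measure (PathSpace d)) B) →
      (∀ᵐ ω ∂(P : Measure (PathSpace d)),
        ν ω ∈ sets (τ (concat s ωbar ω)) (concat s ωbar ω)) →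
      ∀ Pbar : ProbabilityMeasure (PathSpace d),
        (∀ A, MeasurableSet A → (Pbar : Measure (PathSpace d)) A =
          ∫⁻ ω, (ν ω : Measure (PathSpace d))
            {ω' | concat (shiftedTime τ s ωbar ω) ω ω' ∈ A} ∂(P : Measure (PathSpace d))) →
        Pbar ∈ sets s ωbar

namespace PriorFamily

variable (𝒬 : PriorFamily d)

/-- The set of priors `𝒬 = 𝒬(0, ω)`, which does not depend on `ω`; here `ω` is the zero path. -/
def priors : Set (ProbabilityMeasure (PathSpace d)) := 𝒬.sets 0 ⟨0, rfl⟩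

/-- `𝒬(σ, Q)`: the priors that coincide with `Q` on `𝓕_σ`. -/
def agreeing {σ : PathSpace d → ℝ≥0} (hσ : IsFiniteStoppingTime σ)
    (Q : ProbabilityMeasure (PathSpace d)) : Set (ProbabilityMeasure (PathSpace d)) :=
  {Q' ∈ 𝒬.priors | ∀ A, MeasurableSet[hσ.measurableSpace] A →
    (Q' : Measure (PathSpace d)) A = (Q : Measure (PathSpace d)) A}

/-- `Y = ess sup_{Q' ∈ 𝒬(σ, Q)} E_{Q'}[ξ | 𝓕_σ]`, the essential supremum being taken under `Q`:
`Y` is the `Q`-a.s. least `𝓕_σ`-measurable random variable that dominates all the conditional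
expectations. -/
structure IsEssSupCondExp {σ : PathSpace d → ℝ≥0} (hσ : IsFiniteStoppingTime σ)
    (Q : ProbabilityMeasure (PathSpace d)) (ξ Y : PathSpace d → ℝ) : Prop where
  aestronglyMeasurable :
    AEStronglyMeasurable[hσ.measurableSpace] Y (Q : Measure (PathSpace d))
  upper : ∀ Q' ∈ 𝒬.agreeing hσ Q,
    (Q' : Measure (PathSpace d))[ξ | hσ.measurableSpace] ≤ᵐ[(Q : Measure (PathSpace d))] Y
  least : ∀ Z : PathSpace d → ℝ, Measurable[hσ.measurableSpace] Z →
    (∀ Q' ∈ 𝒬.agreeing hσ Q,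
      (Q' : Measure (PathSpace d))[ξ | hσ.measurableSpace] ≤ᵐ[(Q : Measure (PathSpace d))] Z) →
    Y ≤ᵐ[(Q : Measure (PathSpace d))] Z

end PriorFamily

/-! ### Martingale notions -/

/-- `X` is a `Q`-martingale for `𝔽` (adaptedness being understood up to `Q`-null sets). -/
structure IsMartingaleUnder (Q : ProbabilityMeasure (PathSpace d))
    (X : ℝ≥0 → PathSpace d → ℝ) : Prop where
  adapted : ∀ t, AEStronglyMeasurable[canonFiltration d t] (X t) (Q : Measure (PathSpace d))
  integrable : ∀ t, Integrable (X t) (Q : Measure (PathSpace d))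
  condExp_eq : ∀ s t, s ≤ t →
    (Q : Measure (PathSpace d))[X t | canonFiltration d s] =ᵐ[(Q : Measure (PathSpace d))] X s

/-- `X` is a `Q`-submartingale for `𝔽` (adaptedness being understood up to `Q`-null sets). -/
structure IsSubmartingaleUnder (Q : ProbabilityMeasure (PathSpace d))
    (X : ℝ≥0 → PathSpace d → ℝ) : Prop where
  adapted : ∀ t, AEStronglyMeasurable[canonFiltration d t] (X t) (Q : Measure (PathSpace d))
  integrable : ∀ t, Integrable (X t) (Q : Measure (PathSpace d))
  le_condExp : ∀ s t, s ≤ t →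
    X s ≤ᵐ[(Q : Measure (PathSpace d))] (Q : Measure (PathSpace d))[X t | canonFiltration d s]

/-- `X` is a `Q`-local martingale. -/
def IsLocalMartingaleUnder (Q : ProbabilityMeasure (PathSpace d))
    (X : ℝ≥0 → PathSpace d → ℝ) : Prop :=
  Locally (IsMartingaleUnder Q) (canonFiltration d) X (Q : Measure (PathSpace d))

/-- `X` is a `Q`-local submartingale. -/
def IsLocalSubmartingaleUnder (Q : ProbabilityMeasure (PathSpace d))
    (X : ℝ≥0 → PathSpace d → ℝ) : Prop :=
  Locally (IsSubmartingaleUnder Q) (canonFiltration d) X (Q : Measure (PathSpace d))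

/-- `X` is a `𝒬`-martingale: it is `𝔽*`-adapted, `𝓔₀(X t) = sup_Q E_Q[X t]` is finite and
`X t = 𝓔ₜ(X T)` q.s. for `t ≤ T`, where
`𝓔ₜ(ξ) = ess sup_{Q' ∈ 𝒬(t, Q)} E_{Q'}[ξ | 𝓕ₜ]` `Q`-a.s. for every `Q ∈ 𝒬`. -/
structure IsRobustMartingale (𝒬 : PriorFamily d) (X : ℝ≥0 → PathSpace d → ℝ) : Prop where
  adapted : ∀ t, Measurable[universalCompletion (canonFiltration d t)] (X t)
  integrable : ∀ t, ∀ Q ∈ 𝒬.priors, Integrable (X t) (Q : Measure (PathSpace d))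
  bddAbove : ∀ t, BddAbove ((fun Q : ProbabilityMeasure (PathSpace d) =>
    ∫ ω, X t ω ∂(Q : Measure (PathSpace d))) '' 𝒬.priors)
  condExp_eq : ∀ t T : ℝ≥0, t ≤ T → ∀ Q ∈ 𝒬.priors,
    𝒬.IsEssSupCondExp (isStoppingTime_const (canonFiltration d) t) Q (X T) (X t)

/-- `X` is a symmetric `𝒬`-martingale: both `X` and `-X` are `𝒬`-martingales. -/
def IsSymmetricMartingale (𝒬 : PriorFamily d) (X : ℝ≥0 → PathSpace d → ℝ) : Prop :=
  IsRobustMartingale 𝒬 X ∧ IsRobustMartingale 𝒬 (fun t ω => -X t ω)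

/-! ### The market with infinite horizon -/

/-- The value `S_τ 1_{τ < ∞}` of the asset at maturity. -/
def payoffOf (S : ℝ≥0 → PathSpace d → ℝ) (τ : PathSpace d → WithTop ℝ≥0) (ω : PathSpace d) : ℝ :=
  if τ ω = ⊤ then 0 else S ((τ ω).untopD 0) ω

/-- The wealth `W_t = S_t 1_{t < τ} + S_τ 1_{τ ≤ t}` generated from owning the asset. -/
def wealthOf (S : ℝ≥0 → PathSpace d → ℝ) (τ : PathSpace d → WithTop ℝ≥0)
    (t : ℝ≥0) (ω : PathSpace d) : ℝ :=
  if (t : WithTop ℝ≥0) < τ ω then S t ω else payoffOf S τ ω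

/-- A market with infinite horizon: a discounted risky asset with nonnegative price `S` and
maturity `τ`, whose wealth process is a `Q`-local martingale for every prior `Q`. -/
structure Market (𝒬 : PriorFamily d) where
  /-- the price process -/
  S : ℝ≥0 → PathSpace d → ℝ
  /-- the maturity -/
  τ : PathSpace d → WithTop ℝ≥0
  adapted : ∀ t, Measurable[universalCompletion (canonFiltration d t)] (S t)
  rightContinuous : ∀ ω t, ContinuousWithinAt (fun u => S u ω) (Set.Ici t) t
  continuous : ∀ Q ∈ 𝒬.priors, ∀ᵐ ω ∂(Q : Measure (PathSpace d)), Continuous fun u => S u ω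
  nonneg : ∀ Q ∈ 𝒬.priors, ∀ᵐ ω ∂(Q : Measure (PathSpace d)), ∀ t, 0 ≤ S t ω
  isStoppingTime : IsStoppingTime (canonFiltration d) τ
  maturity_pos : ∀ Q ∈ 𝒬.priors, ∀ᵐ ω ∂(Q : Measure (PathSpace d)), 0 < τ ω
  wealth_localMartingale : ∀ Q ∈ 𝒬.priors, IsLocalMartingaleUnder Q (wealthOf S τ)

namespace Market

variable {𝒬 : PriorFamily d} (M : Market 𝒬)

/-- `S_τ 1_{τ < ∞}` -/
def payoff : PathSpace d → ℝ := payoffOf M.S M.τ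

/-- `W` -/
def wealth : ℝ≥0 → PathSpace d → ℝ := wealthOf M.S M.τ

/-- `Sstar` is the robust fundamental value of the asset: at every finite stopping time `σ`
(in particular at every fixed time) and for every `Q ∈ 𝒬`,
`S*_σ = (ess sup_{Q' ∈ 𝒬(σ, Q)} E_{Q'}[S_τ 1_{τ < ∞} | 𝓕_σ]) 1_{σ < τ}`, `Q`-a.s. -/
def IsFundamentalValue (Sstar : ℝ≥0 → PathSpace d → ℝ) : Prop :=
  ∀ (σ : PathSpace d → ℝ≥0) (hσ : IsFiniteStoppingTime σ), ∀ Q ∈ 𝒬.priors,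
    ∃ Y : PathSpace d → ℝ, 𝒬.IsEssSupCondExp hσ Q M.payoff Y ∧
      (fun ω => Sstar (σ ω) ω) =ᵐ[(Q : Measure (PathSpace d))]
        {ω | (σ ω : WithTop ℝ≥0) < M.τ ω}.indicator Y

/-- The fundamental wealth `W*_t = S*_t + S_τ 1_{τ ≤ t}`. -/
def fundamentalWealth (Sstar : ℝ≥0 → PathSpace d → ℝ) (t : ℝ≥0) (ω : PathSpace d) : ℝ :=
  Sstar t ω + {ω | M.τ ω ≤ t}.indicator M.payoff ω

/-- The bubble `β = W - W*`; before maturity this is `S - S*`. -/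
def bubble (Sstar : ℝ≥0 → PathSpace d → ℝ) (t : ℝ≥0) (ω : PathSpace d) : ℝ :=
  M.wealth t ω - M.fundamentalWealth Sstar t ω

/-- There is a robust bubble: `Q(β_σ > 0) > 0` for some stopping time `σ` and some `Q ∈ 𝒬`. -/
def HasRobustBubble (Sstar : ℝ≥0 → PathSpace d → ℝ) : Prop :=
  ∃ σ : PathSpace d → ℝ≥0, IsFiniteStoppingTime σ ∧ ∃ Q ∈ 𝒬.priors,
    0 < (Q : Measure (PathSpace d)) {ω | 0 < M.bubble Sstar (σ ω) ω}

end Market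

end RobustBubbles

end

open RobustBubbles

/-!
The bubble is `β = W - W*`, where `W` is a local martingale under every prior. The point of the
proof is that `W*` behaves as a supermartingale under every prior, at all finite stopping times:
for `ρ ≤ σ` the essential supremum of the conditional expectations of the payoff given `𝓕_σ`,
averaged given `𝓕_ρ`, does not exceed the one given `𝓕_ρ`
(`PriorFamily.IsEssSupCondExp.integrable_and_condExp_le`).

This rests on pasting (`PriorFamily.exists_agreeing_restrict_eq`): if countably many priors coincide
on `𝓕_σ`, then one may switch to the `n`-th of them on the `n`-th event of a partition from `𝓕_σ`,
and the result is again a prior. It follows by exhaustion that a single prior attains the essential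
supremum up to `ε` (`PriorFamily.IsEssSupCondExp.exists_sub_le`), and the averaging inequality is
then the tower property under that prior. Pasting requires that the conditional laws of one prior
are admissible almost surely under another prior that coincides with it on `𝓕_σ`. A disintegration
argument (`PriorFamily.ae_mem_sets_of_agree`) gives this: admissibility depends on the path only up
to `σ` (Galmarino's test), so the conditional law at an exceptional path charges only exceptional
paths.

To localize, note that `W*` equals the payoff from maturity on, so that `β` vanishes there, and that
on `{s ≤ T}` conditioning at `s` is conditioning at `s ∧ T`. The payoff is integrable under every
prior by Fatou's lemma applied to the nonnegative local martingale `W`.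

If the asset never matures, all conditional expectations of the payoff vanish, hence so does the
fundamental value, and the whole price is a bubble. Fiat money is an instance; the point masses form
an admissible family of priors.
-/

noncomputable section

namespace RobustBubbles

/-! ### The path space -/

variable {d : ℕ}

@[ext]
theorem PathSpace.ext {ω ω' : PathSpace d} (h : ∀ u, ω u = ω' u) : ω = ω' :=
  Subtype.ext (ContinuousMap.ext h)

instance : PolishSpace (PathSpace d) := by
  have : PolishSpace C(ℝ≥0, EuclideanSpace ℝ (Fin d)) := inferInstance
  have hc : IsClosed {ω : C(ℝ≥0, EuclideanSpace ℝ (Fin d)) | ω 0 = 0} :=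
    isClosed_eq (ContinuousEvalConst.continuous_eval_const 0) continuous_const
  exact hc.polishSpace

theorem continuous_eval_uncurry :
    Continuous (fun p : PathSpace d × ℝ≥0 => p.1 p.2) :=
  (ContinuousEval.continuous_eval (F := C(ℝ≥0, EuclideanSpace ℝ (Fin d)))).comp
    ((continuous_subtype_val.comp continuous_fst).prodMk continuous_snd)

/-- The Borel `σ`-algebra of the path space is generated by the coordinates: evaluation along a
dense sequence is a continuous injection between Polish spaces, hence a measurable embedding. -/
theorem measurable_pathSpace_of_eval {X : Type*} [MeasurableSpace X] {f : X → PathSpace d}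
    (hf : ∀ u, Measurable fun x => f x u) : Measurable f := by
  let Φ : PathSpace d → ℕ → EuclideanSpace ℝ (Fin d) :=
    fun ω n => ω (TopologicalSpace.denseSeq ℝ≥0 n)
  have hΦ : Continuous Φ := continuous_pi fun n => continuous_eval _
  have hinj : Function.Injective Φ := fun ω ω' h => PathSpace.ext fun u => congrFun
    ((TopologicalSpace.denseRange_denseSeq ℝ≥0).equalizer ω.1.continuous ω'.1.continuous h) u
  exact (hΦ.measurableEmbedding hinj).measurable_comp_iff.1
    (measurable_pi_lambda _ fun n => hf _)

@[simp]
theorem concat_apply (s u : ℝ≥0) (ω ω' : PathSpace d) :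
    concat s ω ω' u = ω (min u s) + ω' (u - s) := rfl

theorem concat_eq_of_le {s u : ℝ≥0} (h : u ≤ s) (ω ω' : PathSpace d) :
    concat s ω ω' u = ω u := by
  have h0 : ω' 0 = 0 := ω'.2
  simp [h, tsub_eq_zero_of_le h, h0]

theorem concat_shift (s : ℝ≥0) (ω : PathSpace d) : concat s ω (shift s ω) = ω := by
  ext1 u
  change ω (min u s) + (ω (s + (u - s)) - ω s) = ω u
  rcases le_total u s with h | h
  · simp [h, tsub_eq_zero_of_le h]
  · simp [h, add_tsub_cancel_of_le h]

theorem concat_zero (ω ω' : PathSpace d) : concat 0 ω ω' = ω' := by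
  ext1 u
  have h0 : ω 0 = 0 := ω.2
  simp [h0]

theorem shiftedTime_zero (σ : PathSpace d → ℝ≥0) (ω : PathSpace d) : shiftedTime σ 0 ω = σ := by
  funext ω'
  simp [shiftedTime, concat_zero]

/-! ### Information up to a stopping time -/

theorem canonFiltration_eq (t : ℝ≥0) : (canonFiltration d t : MeasurableSpace (PathSpace d)) =
    ⨆ j ≤ t, MeasurableSpace.comap (fun ω : PathSpace d => ω j) inferInstance := rfl

/-- Events of `𝓕ₜ` only depend on the path up to time `t`. -/
theorem mem_iff_of_eqOn {t : ℝ≥0} {A : Set (PathSpace d)}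
    (hA : MeasurableSet[canonFiltration d t] A) {ω ω' : PathSpace d} (h : ∀ u ≤ t, ω u = ω' u) :
    ω ∈ A ↔ ω' ∈ A := by
  -- the sets that do not separate `ω` and `ω'` form a `σ`-algebra
  let m : MeasurableSpace (PathSpace d) :=
    { MeasurableSet' := fun A => (ω ∈ A ↔ ω' ∈ A)
      measurableSet_empty := by simp
      measurableSet_compl := fun A hA => by simp [hA]
      measurableSet_iUnion := fun f hf => by simp [hf] }
  have hle : (canonFiltration d t : MeasurableSpace (PathSpace d)) ≤ m := by
    rw [canonFiltration_eq]
    refine iSup₂_le fun j hj => ?_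
    rintro _ ⟨B, -, rfl⟩
    change ω j ∈ B ↔ ω' j ∈ B
    rw [h j hj]
  exact hle A hA

/-- The initial `σ`-algebra is trivial because all paths start at `0`. -/
theorem eq_empty_or_univ_of_measurableSet_zero {A : Set (PathSpace d)}
    (hA : MeasurableSet[canonFiltration d 0] A) : A = ∅ ∨ A = Set.univ := by
  refine A.eq_empty_or_nonempty.imp_right fun ⟨ω, hω⟩ => Set.eq_univ_of_forall fun ω' =>
    (mem_iff_of_eqOn hA fun u hu => ?_).1 hω
  have h0 : ω 0 = 0 := ω.2
  have h0' : ω' 0 = 0 := ω'.2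
  rw [nonpos_iff_eq_zero.1 hu, h0, h0']

variable {σ : PathSpace d → ℝ≥0}

theorem IsFiniteStoppingTime.measurableSet_le_coe (hσ : IsFiniteStoppingTime σ) (t : ℝ≥0) :
    MeasurableSet[canonFiltration d t] {ω | σ ω ≤ t} := by
  have h := hσ t
  simp only [WithTop.coe_le_coe] at h
  exact h

/-- Paths that coincide up to `σ` share the value of `σ`. -/
theorem IsFiniteStoppingTime.eq_of_eqOn (hσ : IsFiniteStoppingTime σ) {ω ω' : PathSpace d}
    (h : ∀ u ≤ σ ω, ω u = ω' u) : σ ω' = σ ω := by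
  have h1 : σ ω' ≤ σ ω := by
    simpa using mem_iff_of_eqOn (hσ.measurableSet_le_coe (σ ω)) h
  refine le_antisymm h1 ?_
  simpa using mem_iff_of_eqOn (hσ.measurableSet_le_coe (σ ω')) fun u hu => h u (hu.trans h1)

/-- Galmarino's test: events of `𝓕_σ` only depend on the path up to `σ`. -/
theorem IsFiniteStoppingTime.mem_iff_of_eqOn (hσ : IsFiniteStoppingTime σ) {A : Set (PathSpace d)}
    (hA : MeasurableSet[hσ.measurableSpace] A) {ω ω' : PathSpace d}
    (h : ∀ u ≤ σ ω, ω u = ω' u) : ω ∈ A ↔ ω' ∈ A := by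
  have hAt := hA.2 (σ ω)
  have h1 := RobustBubbles.mem_iff_of_eqOn hAt h
  simpa only [Set.mem_inter_iff, Set.mem_ofPred_eq, hσ.eq_of_eqOn h, le_rfl, and_true] using h1

theorem IsFiniteStoppingTime.apply_eq_of_eqOn (hσ : IsFiniteStoppingTime σ)
    {κ : PathSpace d → ProbabilityMeasure (PathSpace d)}
    (hκ : ∀ B, MeasurableSet B →
      Measurable[hσ.measurableSpace] fun ω => (κ ω : Measure (PathSpace d)) B)
    {ω ω' : PathSpace d} (h : ∀ u ≤ σ ω, ω u = ω' u) : κ ω' = κ ω := by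
  refine Subtype.ext (Measure.ext fun B hB => ?_)
  exact (hσ.mem_iff_of_eqOn (hκ B hB (measurableSet_singleton
    ((κ ω : Measure (PathSpace d)) B))) h).1 rfl

theorem IsFiniteStoppingTime.measurable_self (hσ : IsFiniteStoppingTime σ) :
    Measurable[hσ.measurableSpace] σ := by
  exact (IsStoppingTime.measurable hσ).untopD 0

theorem IsFiniteStoppingTime.measurable_eval_min (hσ : IsFiniteStoppingTime σ) (u : ℝ≥0) :
    Measurable[hσ.measurableSpace] fun ω : PathSpace d => ω (min u (σ ω)) := by
  have hprog : IsStronglyProgressive (canonFiltration d)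
      (fun (t : ℝ≥0) (ω : PathSpace d) => ω t) :=
    StronglyAdapted.isStronglyProgressive_of_continuous
      (Filtration.stronglyAdapted_natural _) fun ω => ω.1.continuous
  have hmin : IsStoppingTime (canonFiltration d) fun ω => min (σ ω : WithTop ℝ≥0) (u : ℝ≥0) :=
    hσ.min_const u
  have h := measurable_stoppedValue hprog hmin
  have hle := IsStoppingTime.measurableSpace_mono hmin hσ fun ω => min_le_left _ _
  have h2 := h.mono hle le_rfl
  convert h2 using 2 with ω
  rw [stoppedValue, ← WithTop.coe_min, min_comm]
  rfl

theorem IsFiniteStoppingTime.measurable_shift (hσ : IsFiniteStoppingTime σ) :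
    Measurable fun ω : PathSpace d => shift (σ ω) ω := by
  have hm : Measurable σ := hσ.measurable_self.mono hσ.measurableSpace_le le_rfl
  refine measurable_pathSpace_of_eval fun u => ?_
  change Measurable fun ω : PathSpace d => ω (σ ω + u) - ω (σ ω)
  have he := (continuous_eval_uncurry (d := d)).measurable
  exact (he.comp (measurable_id.prodMk (hm.add_const u))).sub
    (he.comp (measurable_id.prodMk hm))

theorem IsFiniteStoppingTime.measurable_concat (hσ : IsFiniteStoppingTime σ) :
    Measurable[hσ.measurableSpace.prod (borel (PathSpace d))]
      fun p : PathSpace d × PathSpace d => concat (σ p.1) p.1 p.2 := by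
  let _ : MeasurableSpace (PathSpace d × PathSpace d) :=
    hσ.measurableSpace.prod (borel (PathSpace d))
  refine measurable_pathSpace_of_eval fun u => ?_
  have hfst : Measurable[hσ.measurableSpace.prod (borel (PathSpace d)), hσ.measurableSpace]
    (Prod.fst : PathSpace d × PathSpace d → PathSpace d) := @measurable_fst _ _ hσ.measurableSpace _
  have hsnd : Measurable (Prod.snd : PathSpace d × PathSpace d → PathSpace d) :=
    @measurable_snd _ _ hσ.measurableSpace _
  have h1 : Measurable fun p : PathSpace d × PathSpace d => p.1 (min u (σ p.1)) :=
    (hσ.measurable_eval_min u).comp hfst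
  have h2 : Measurable fun p : PathSpace d × PathSpace d => σ p.1 := hσ.measurable_self.comp hfst
  exact h1.add ((continuous_eval_uncurry (d := d)).measurable.comp
    (hsnd.prodMk (h2.const_sub u)))

/-! ### Disintegration and pasting -/

/-- If `K (φ ω)` is the conditional law of `X` given `φ`, then sections of measurable sets of the
product compute the joint law of `(φ, X)`. Here `φ` will be the identity into the path space with
the smaller `σ`-algebra `𝓕_σ`. -/
theorem measure_prodMk_mem_eq_lintegral {Ω Γ β : Type*} [MeasurableSpace Ω] [MeasurableSpace Γ]
    [MeasurableSpace β] {P : Measure Ω} [IsProbabilityMeasure P] {φ : Ω → Γ} (hφ : Measurable φ)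
    {X : Ω → β} (hX : Measurable X) {K : Γ → Measure β} (hprob : ∀ c, IsProbabilityMeasure (K c))
    (hK : ∀ B, MeasurableSet B → Measurable fun c => K c B)
    (hcond : ∀ A B, MeasurableSet A → MeasurableSet B →
      P (φ ⁻¹' A ∩ X ⁻¹' B) = ∫⁻ ω in φ ⁻¹' A, K (φ ω) B ∂P)
    {t : Set (Γ × β)} (ht : MeasurableSet t) :
    (Measurable fun c => K c (Prod.mk c ⁻¹' t)) ∧
      P {ω | (φ ω, X ω) ∈ t} = ∫⁻ ω, K (φ ω) (Prod.mk (φ ω) ⁻¹' t) ∂P := by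
  let κ : Kernel Γ β := ⟨K, Measure.measurable_of_measurable_coe _ hK⟩
  have : IsMarkovKernel κ := ⟨hprob⟩
  have hm : Measurable fun c => κ c (Prod.mk c ⁻¹' t) := Kernel.measurable_kernel_prodMk_left ht
  have hφX : Measurable fun ω => (φ ω, X ω) := hφ.prodMk hX
  have key : P.map (fun ω => (φ ω, X ω)) = P.map φ ⊗ₘ κ := by
    refine Measure.ext_prod fun {A B} hA hB => ?_
    rw [Measure.map_apply hφX (hA.prod hB), Measure.compProd_apply_prod hA hB,
      setLIntegral_map hA (κ.measurable_coe hB) hφ]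
    exact hcond A B hA hB
  refine ⟨hm, ?_⟩
  have := congrArg (fun μ => μ t) key
  simp only [Measure.map_apply hφX ht, Measure.compProd_apply ht, lintegral_map hm hφ] at this
  exact this

/-- Disintegration at a stopping time: the path is recovered by concatenating its past with its
future increments, whose conditional law is `κ`. -/
theorem IsShiftedRCPD.measurable_and_measure_inter {hσ : IsFiniteStoppingTime σ}
    {P : ProbabilityMeasure (PathSpace d)}
    {κ : PathSpace d → ProbabilityMeasure (PathSpace d)} (h : IsShiftedRCPD P hσ κ)
    {N : Set (PathSpace d)} (hN : MeasurableSet N) :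
    (Measurable[hσ.measurableSpace] fun ω =>
        (κ ω : Measure (PathSpace d)) {ω' | concat (σ ω) ω ω' ∈ N}) ∧
      ∀ A, MeasurableSet[hσ.measurableSpace] A → (P : Measure (PathSpace d)) (A ∩ N) =
        ∫⁻ ω in A, (κ ω : Measure (PathSpace d)) {ω' | concat (σ ω) ω ω' ∈ N}
          ∂(P : Measure (PathSpace d)) := by
  have hid : @Measurable _ _ _ hσ.measurableSpace (id : PathSpace d → PathSpace d) :=
    measurable_id.mono le_rfl hσ.measurableSpace_le
  have key := fun t ht => @measure_prodMk_mem_eq_lintegral _ _ _ _ hσ.measurableSpace _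
    (P : Measure (PathSpace d)) _ id hid _ hσ.measurable_shift
    (fun ω => (κ ω : Measure (PathSpace d))) (fun ω => inferInstance) h.measurable h.cond t ht
  have hc := hσ.measurable_concat hN
  refine ⟨(key _ hc).1, fun A hA => ?_⟩
  have hA' : MeasurableSet[hσ.measurableSpace.prod (borel (PathSpace d))]
      ((Prod.fst : PathSpace d × PathSpace d → PathSpace d) ⁻¹' A) :=
    (@measurable_fst _ _ hσ.measurableSpace _) hA
  have h2 := (key _ (hA'.inter hc)).2
  rw [← lintegral_indicator (hσ.measurableSpace_le _ hA)]
  convert h2 using 2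
  · ext ω
    simp [concat_shift]
  · ext ω
    by_cases hω : ω ∈ A
    · simp only [Set.indicator_of_mem hω]
      congr 1
      ext ω'
      simp [hω]
    · simp only [Set.indicator_of_notMem hω]
      rw [eq_comm]
      refine (congrArg _ (Set.eq_empty_iff_forall_notMem.2 fun ω' h' => hω ?_)).trans measure_empty
      exact h'.1

/-- Membership in the sets of priors passes between measures that coincide on `𝓕_σ`. The
exceptional set depends on the path only up to `σ`; by disintegration, if it is contained in a
null set then it is contained in a null set that belongs to `𝓕_σ`. -/
theorem PriorFamily.ae_mem_sets_of_agree (𝒬 : PriorFamily d) {hσ : IsFiniteStoppingTime σ}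
    {P Q : ProbabilityMeasure (PathSpace d)}
    (hPQ : ∀ A, MeasurableSet[hσ.measurableSpace] A →
      (P : Measure (PathSpace d)) A = (Q : Measure (PathSpace d)) A)
    {κ : PathSpace d → ProbabilityMeasure (PathSpace d)} (h : IsShiftedRCPD P hσ κ)
    (hmem : ∀ᵐ ω ∂(P : Measure (PathSpace d)), κ ω ∈ 𝒬.sets (σ ω) ω) :
    ∀ᵐ ω ∂(Q : Measure (PathSpace d)), κ ω ∈ 𝒬.sets (σ ω) ω := by
  obtain ⟨N, hsub, hN, hN0⟩ := exists_measurable_superset_of_null (ae_iff.1 hmem)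
  obtain ⟨hmeas, hint⟩ := h.measurable_and_measure_inter hN
  have h0 := hint Set.univ MeasurableSet.univ
  rw [Set.univ_inter, hN0, Measure.restrict_univ, eq_comm,
    lintegral_eq_zero_iff (hmeas.mono hσ.measurableSpace_le le_rfl)] at h0
  have hB : MeasurableSet[hσ.measurableSpace]
      ((fun ω => (κ ω : Measure (PathSpace d)) {ω' | concat (σ ω) ω ω' ∈ N}) ⁻¹' {0}ᶜ) :=
    hmeas (measurableSet_singleton 0).compl
  have hQ0 := (hPQ _ hB).symm.trans (ae_iff.1 h0)
  refine measure_mono_null (fun ω hω => ?_) hQ0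
  -- the exceptional set contains every continuation of a path that it contains
  have hall : {ω' | concat (σ ω) ω ω' ∈ N} = Set.univ := by
    refine Set.eq_univ_of_forall fun ω' => hsub ?_
    have heq : ∀ u ≤ σ ω, ω u = concat (σ ω) ω ω' u := fun u hu => (concat_eq_of_le hu _ _).symm
    have hs := 𝒬.nonanticipative (σ ω) ω _ heq
    simp only [Set.mem_ofPred_eq, Set.mem_compl_iff] at hω ⊢
    rwa [hσ.eq_of_eqOn heq, hσ.apply_eq_of_eqOn h.measurable heq, ← hs]
  simp [hall]

theorem PriorFamily.exists_isShiftedRCPD (𝒬 : PriorFamily d) (hσ : IsFiniteStoppingTime σ)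
    {P : ProbabilityMeasure (PathSpace d)} (hP : P ∈ 𝒬.priors) :
    ∃ κ : PathSpace d → ProbabilityMeasure (PathSpace d), IsShiftedRCPD P hσ κ ∧
      ∀ᵐ ω ∂(P : Measure (PathSpace d)), κ ω ∈ 𝒬.sets (σ ω) ω := by
  have h := 𝒬.invariance 0 ⟨0, rfl⟩ σ hσ (fun _ => bot_le) P hP
  have hc : ∀ ω : PathSpace d, concat 0 ⟨0, rfl⟩ ω = ω := concat_zero _
  simp only [hc] at h
  have aux : ∀ (θ : PathSpace d → ℝ≥0) (hθ : IsFiniteStoppingTime θ), θ = σ →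
      ∀ κ, IsShiftedRCPD P hθ κ → IsShiftedRCPD P hσ κ := by
    rintro θ hθ rfl κ hκ
    exact hκ
  obtain ⟨κ, hκ, hmem⟩ := h
  exact ⟨κ, aux _ _ (shiftedTime_zero σ _) κ hκ, hmem⟩

theorem PriorFamily.mem_priors_of_pasting (𝒬 : PriorFamily d) (hσ : IsFiniteStoppingTime σ)
    {P : ProbabilityMeasure (PathSpace d)} (hP : P ∈ 𝒬.priors)
    {ν : PathSpace d → ProbabilityMeasure (PathSpace d)}
    (hν : ∀ B, MeasurableSet B →
      Measurable[hσ.measurableSpace] fun ω => (ν ω : Measure (PathSpace d)) B)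
    (hmem : ∀ᵐ ω ∂(P : Measure (PathSpace d)), ν ω ∈ 𝒬.sets (σ ω) ω)
    {R : ProbabilityMeasure (PathSpace d)}
    (hR : ∀ A, MeasurableSet A → (R : Measure (PathSpace d)) A =
      ∫⁻ ω, (ν ω : Measure (PathSpace d)) {ω' | concat (σ ω) ω ω' ∈ A}
        ∂(P : Measure (PathSpace d))) :
    R ∈ 𝒬.priors := by
  have hc : ∀ ω : PathSpace d, concat 0 ⟨0, rfl⟩ ω = ω := concat_zero _
  have hs : shiftedTime σ 0 ⟨0, rfl⟩ = σ := shiftedTime_zero σ _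
  refine 𝒬.pasting 0 ⟨0, rfl⟩ σ hσ (fun _ => bot_le) P hP ν ?_ ?_ R ?_
  · have aux : ∀ (θ : PathSpace d → ℝ≥0) (hθ : IsFiniteStoppingTime θ), θ = σ →
        ∀ B, MeasurableSet B →
          Measurable[hθ.measurableSpace] fun ω => (ν ω : Measure (PathSpace d)) B := by
      rintro θ hθ rfl
      exact hν
    exact aux _ _ (shiftedTime_zero σ _)
  · simpa only [hc] using hmem
  · simpa only [hs] using hR

/-- Priors that coincide on `𝓕_σ` can be pasted along a countable partition from `𝓕_σ`. The
partition is given by the level sets of `N`, and the pasted kernel uses the conditional law of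
`R n` on `{N = n}`. -/
theorem PriorFamily.exists_agreeing_restrict_eq (𝒬 : PriorFamily d) (hσ : IsFiniteStoppingTime σ)
    {Q : ProbabilityMeasure (PathSpace d)} (hQ : Q ∈ 𝒬.priors)
    {R : ℕ → ProbabilityMeasure (PathSpace d)} (hR : ∀ n, R n ∈ 𝒬.agreeing hσ Q)
    {N : PathSpace d → ℕ} (hN : Measurable[hσ.measurableSpace] N) :
    ∃ P ∈ 𝒬.agreeing hσ Q, ∀ n, (P : Measure (PathSpace d)).restrict (N ⁻¹' {n}) =
      (R n : Measure (PathSpace d)).restrict (N ⁻¹' {n}) := by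
  have hle := hσ.measurableSpace_le
  have hNm : ∀ n, MeasurableSet[hσ.measurableSpace] (N ⁻¹' {n}) := fun n =>
    hN (measurableSet_singleton n)
  choose κ hκ hmem using fun n => 𝒬.exists_isShiftedRCPD hσ (hR n).1
  have hmemQ := fun n => 𝒬.ae_mem_sets_of_agree (hR n).2 (hκ n) (hmem n)
  let P0 : Measure (PathSpace d) :=
    Measure.sum fun n => (R n : Measure (PathSpace d)).restrict (N ⁻¹' {n})
  have hP0 : ∀ A, MeasurableSet A →
      P0 A = ∑' n, (R n : Measure (PathSpace d)) (A ∩ N ⁻¹' {n}) := fun A hA => by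
    rw [Measure.sum_apply _ hA]
    exact tsum_congr fun n => Measure.restrict_apply hA
  have hpart : ∀ A, MeasurableSet A → ∀ μ : Measure (PathSpace d),
      ∑' n, μ (A ∩ N ⁻¹' {n}) = μ A := fun A hA μ => by
    rw [← measure_iUnion]
    · congr 1
      ext ω
      simp
    · intro i j hij
      refine Set.disjoint_left.2 fun ω h1 h2 => hij ?_
      simp only [Set.mem_inter_iff, Set.mem_preimage, Set.mem_singleton_iff] at h1 h2
      exact h1.2.symm.trans h2.2
    · exact fun n => hA.inter (hle _ (hNm n))
  have hP0Q : ∀ A, MeasurableSet[hσ.measurableSpace] A →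
      P0 A = (Q : Measure (PathSpace d)) A := fun A hA => by
    rw [hP0 A (hle _ hA), ← hpart A (hle _ hA)]
    exact tsum_congr fun n => (hR n).2 _ (hA.inter (hNm n))
  have hprob : IsProbabilityMeasure P0 := ⟨by rw [hP0Q _ MeasurableSet.univ]; exact measure_univ⟩
  have hν : ∀ B : PathSpace d → Set (PathSpace d),
      (∀ n, Measurable[hσ.measurableSpace] fun ω => (κ n ω : Measure (PathSpace d)) (B ω)) →
      Measurable[hσ.measurableSpace] fun ω => (κ (N ω) ω : Measure (PathSpace d)) (B ω) :=
    fun B hB => (measurable_from_prod_countable_right (mβ := hσ.measurableSpace)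
      (f := fun p : ℕ × PathSpace d => (κ p.1 p.2 : Measure (PathSpace d)) (B p.2)) hB).comp
      (hN.prodMk (@measurable_id _ hσ.measurableSpace))
  refine ⟨⟨P0, hprob⟩, ⟨𝒬.mem_priors_of_pasting hσ hQ (ν := fun ω => κ (N ω) ω)
    (fun B hB => hν (fun _ => B) fun n => (hκ n).measurable B hB) ?_ ?_, hP0Q⟩, fun n => ?_⟩
  · filter_upwards [ae_all_iff.2 hmemQ] with ω hω using hω _
  · intro A hA
    have hm := fun n => ((hκ n).measurable_and_measure_inter hA).1
    have hm' := hν (fun ω => {ω' | concat (σ ω) ω ω' ∈ A}) hm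
    have hU : (Set.univ : Set (PathSpace d)) = ⋃ n, N ⁻¹' {n} := by
      ext ω
      simp
    change P0 A = _
    rw [hP0 A hA, ← setLIntegral_univ, hU, lintegral_iUnion (fun n => hle _ (hNm n))]
    · refine tsum_congr fun n => ?_
      rw [Set.inter_comm, ((hκ n).measurable_and_measure_inter hA).2 _ (hNm n)]
      have hind := (hm n).indicator (hNm n)
      have htrim : (R n : Measure (PathSpace d)).trim hle = (Q : Measure (PathSpace d)).trim hle :=
        @Measure.ext _ hσ.measurableSpace _ _ fun s hs => by
          rw [trim_measurableSet_eq hle hs, trim_measurableSet_eq hle hs, (hR n).2 s hs]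
      rw [← setLIntegral_trim hle (hm n) (hNm n), htrim, setLIntegral_trim hle (hm n) (hNm n)]
      refine setLIntegral_congr_fun (hle _ (hNm n)) fun ω hω => ?_
      simp only [Set.mem_preimage, Set.mem_singleton_iff] at hω
      simp only [hω]
    · intro i j hij
      refine Set.disjoint_left.2 fun ω h1 h2 => hij ?_
      simp only [Set.mem_preimage, Set.mem_singleton_iff] at h1 h2
      exact h1.symm.trans h2
  · refine Measure.ext fun A hA => ?_
    change P0.restrict _ A = _
    rw [Measure.restrict_apply hA, Measure.restrict_apply hA,
      hP0 _ (hA.inter (hle _ (hNm n))), tsum_eq_single n]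
    · rw [Set.inter_assoc, Set.inter_self]
    · intro k hk
      convert measure_empty (μ := (R k : Measure (PathSpace d)))
      ext ω
      simp only [Set.mem_inter_iff, Set.mem_preimage, Set.mem_singleton_iff,
        Set.mem_empty_iff_false, iff_false]
      rintro ⟨⟨-, h1⟩, h2⟩
      exact hk (h2.symm.trans h1)

/-! ### Conditional expectations under measures that coincide on a sub-`σ`-algebra -/

section Agree

variable {Ω : Type*} {m₁ m m₀ : MeasurableSpace Ω} {P Q : Measure Ω}

theorem trim_eq_trim_of_agree (hm : m ≤ m₀) (h : ∀ A, MeasurableSet[m] A → P A = Q A) :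
    P.trim hm = Q.trim hm :=
  @Measure.ext _ m _ _ fun s hs => by
    rw [trim_measurableSet_eq hm hs, trim_measurableSet_eq hm hs, h s hs]

theorem ae_of_ae_of_agree (h : ∀ A, MeasurableSet[m] A → P A = Q A) {p : Ω → Prop}
    (hp : MeasurableSet[m] {ω | p ω}) (hP : ∀ᵐ ω ∂P, p ω) : ∀ᵐ ω ∂Q, p ω := by
  rw [ae_iff] at hP ⊢
  rwa [← h _ (by simpa only [Set.compl_ofPred] using hp.compl)]

theorem integrable_of_agree (hm : m ≤ m₀) (h : ∀ A, MeasurableSet[m] A → P A = Q A)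
    {f : Ω → ℝ} (hf : StronglyMeasurable[m] f) (hP : Integrable f P) : Integrable f Q := by
  have h1 := hP.trim hm hf
  rw [trim_eq_trim_of_agree hm h] at h1
  exact integrable_of_integrable_trim hm h1

theorem condExp_ae_eq_of_agree [IsFiniteMeasure P] [IsFiniteMeasure Q] (hm : m ≤ m₀)
    (hm₁ : m₁ ≤ m) (h : ∀ A, MeasurableSet[m] A → P A = Q A)
    {f : Ω → ℝ} (hf : StronglyMeasurable[m] f) (hP : Integrable f P) :
    P[f | m₁] =ᵐ[Q] Q[f | m₁] := by
  have hQ := integrable_of_agree hm h hf hP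
  have hg : StronglyMeasurable[m₁] (P[f | m₁]) := stronglyMeasurable_condExp
  have hgQ : Integrable (P[f | m₁]) Q :=
    integrable_of_agree hm h (hg.mono hm₁) integrable_condExp
  refine ae_eq_condExp_of_forall_setIntegral_eq (hm₁.trans hm) hQ
    (fun _ _ _ => hgQ.integrableOn) (fun s hs _ => ?_) hg.aestronglyMeasurable
  rw [setIntegral_trim hm (hg.mono hm₁) (hm₁ s hs), setIntegral_trim hm hf (hm₁ s hs),
    ← trim_eq_trim_of_agree hm h, ← setIntegral_trim hm (hg.mono hm₁) (hm₁ s hs),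
    ← setIntegral_trim hm hf (hm₁ s hs), setIntegral_condExp (hm₁.trans hm) hP hs]

theorem condExp_ae_eq_of_restrict_eq {R : Measure Ω} [IsFiniteMeasure P] [IsFiniteMeasure R]
    (hm : m ≤ m₀) (h : ∀ A, MeasurableSet[m] A → P A = Q A) {B : Set Ω}
    (hB : MeasurableSet[m] B) (hPR : P.restrict B = R.restrict B) {f : Ω → ℝ}
    (hP : Integrable f P) (hR : Integrable f R) :
    ∀ᵐ ω ∂Q, ω ∈ B → (P[f | m]) ω = (R[f | m]) ω := by
  have h1 := condExp_restrict_ae_eq_restrict hm hB hP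
  have h2 := condExp_restrict_ae_eq_restrict hm hB hR
  rw [← hPR] at h2
  have h3 := (ae_restrict_iff' (hm _ hB)).1 (h1.symm.trans h2)
  have hset : MeasurableSet[m] {ω | (P[f | m]) ω = (R[f | m]) ω} :=
    stronglyMeasurable_condExp.measurableSet_eq_fun stronglyMeasurable_condExp
  refine ae_of_ae_of_agree h ?_ h3
  have : {ω | ω ∈ B → (P[f | m]) ω = (R[f | m]) ω} =
      Bᶜ ∪ {ω | (P[f | m]) ω = (R[f | m]) ω} := by
    ext ω
    simp [imp_iff_not_or]
  rw [this]
  exact hB.compl.union hset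

end Agree

namespace PriorFamily

variable {𝒬 : PriorFamily d}

theorem self_mem_agreeing {hσ : IsFiniteStoppingTime σ} {Q : ProbabilityMeasure (PathSpace d)}
    (hQ : Q ∈ 𝒬.priors) : Q ∈ 𝒬.agreeing hσ Q := ⟨hQ, fun _ _ => rfl⟩

/-! ### Near-optimal priors and the dynamic programming inequality -/

/-- Near-optimal priors, on a countable union of events of `𝓕_σ`, exist if they exist on each of
the events: paste them along the first event that occurs. -/
theorem exists_agreeing_ae_iUnion {hσ : IsFiniteStoppingTime σ}
    {Q : ProbabilityMeasure (PathSpace d)} (hQ : Q ∈ 𝒬.priors) {ξ Y : PathSpace d → ℝ}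
    (hξ : ∀ P ∈ 𝒬.priors, Integrable ξ (P : Measure (PathSpace d)))
    {A : ℕ → Set (PathSpace d)} (hA : ∀ n, MeasurableSet[hσ.measurableSpace] (A n))
    (h : ∀ n, ∃ P ∈ 𝒬.agreeing hσ Q, ∀ᵐ ω ∂(Q : Measure (PathSpace d)), ω ∈ A n →
      Y ω ≤ ((P : Measure (PathSpace d))[ξ | hσ.measurableSpace]) ω) :
    ∃ P ∈ 𝒬.agreeing hσ Q, ∀ᵐ ω ∂(Q : Measure (PathSpace d)), ω ∈ ⋃ n, A n →
      Y ω ≤ ((P : Measure (PathSpace d))[ξ | hσ.measurableSpace]) ω := by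
  classical
  choose R hR hRA using h
  have hex : ∀ ω, ∃ n, ω ∈ A n ∨ ω ∉ ⋃ k, A k := fun ω => by
    by_cases hω : ω ∈ ⋃ k, A k
    · exact (Set.mem_iUnion.1 hω).imp fun _ => Or.inl
    · exact ⟨0, Or.inr hω⟩
  let N : PathSpace d → ℕ := fun ω => Nat.find (hex ω)
  have hN : Measurable[hσ.measurableSpace] N :=
    @measurable_find _ hσ.measurableSpace _ _ hex fun k =>
      (hA k).union (MeasurableSet.iUnion hA).compl
  obtain ⟨P, hP, hPR⟩ := 𝒬.exists_agreeing_restrict_eq hσ hQ hR hN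
  refine ⟨P, hP, ?_⟩
  have heq := fun n => condExp_ae_eq_of_restrict_eq hσ.measurableSpace_le hP.2
    (hN (measurableSet_singleton n)) (hPR n) (hξ P hP.1) (hξ _ (hR n).1)
  filter_upwards [ae_all_iff.2 heq, ae_all_iff.2 hRA] with ω h1 h2 hω
  rw [h1 (N ω) rfl]
  exact h2 (N ω) ((Nat.find_spec (hex ω)).resolve_right fun h => h hω)

/-- The essential supremum is attained up to `ε`, by exhaustion: the events on which some prior is
`ε`-optimal are stable under countable unions, and a largest one has full measure because the
essential supremum could be lowered by `ε` on its complement. -/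
theorem IsEssSupCondExp.exists_sub_le {hσ : IsFiniteStoppingTime σ}
    {Q : ProbabilityMeasure (PathSpace d)} (hQ : Q ∈ 𝒬.priors) {ξ Y : PathSpace d → ℝ}
    (hξ : ∀ P ∈ 𝒬.priors, Integrable ξ (P : Measure (PathSpace d)))
    (hY : 𝒬.IsEssSupCondExp hσ Q ξ Y) (hYm : Measurable[hσ.measurableSpace] Y)
    {ε : ℝ} (hε : 0 < ε) :
    ∃ P ∈ 𝒬.agreeing hσ Q, ∀ᵐ ω ∂(Q : Measure (PathSpace d)),
      Y ω - ε ≤ ((P : Measure (PathSpace d))[ξ | hσ.measurableSpace]) ω := by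
  classical
  have hle := hσ.measurableSpace_le
  let C : Set (Set (PathSpace d)) := {A | MeasurableSet[hσ.measurableSpace] A ∧
    ∃ P ∈ 𝒬.agreeing hσ Q, ∀ᵐ ω ∂(Q : Measure (PathSpace d)), ω ∈ A →
      Y ω - ε ≤ ((P : Measure (PathSpace d))[ξ | hσ.measurableSpace]) ω}
  have hC : ∀ A : ℕ → Set (PathSpace d), (∀ n, A n ∈ C) → (⋃ n, A n) ∈ C := fun A hA =>
    ⟨MeasurableSet.iUnion fun n => (hA n).1,
      exists_agreeing_ae_iUnion hQ hξ (fun n => (hA n).1) fun n => (hA n).2⟩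
  have hne : ((fun A => (Q : Measure (PathSpace d)) A) '' C).Nonempty :=
    ⟨_, ∅, ⟨@MeasurableSet.empty _ hσ.measurableSpace, Q, self_mem_agreeing hQ, by simp⟩, rfl⟩
  obtain ⟨u, -, hu, huC⟩ := exists_seq_tendsto_sSup hne (OrderTop.bddAbove _)
  choose A hA hAu using huC
  let U := ⋃ n, A n
  have hU : U ∈ C := hC A hA
  have hmax : ∀ B ∈ C, (Q : Measure (PathSpace d)) B ≤ (Q : Measure (PathSpace d)) U :=
    fun B hB => (le_sSup (Set.mem_image_of_mem _ hB)).trans <| le_of_tendsto' hu fun n => by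
      rw [← hAu n]
      exact measure_mono (Set.subset_iUnion A n)
  obtain ⟨P, hP, hPU⟩ := hU.2
  refine ⟨P, hP, ?_⟩
  let Z : PathSpace d → ℝ := U.piecewise Y fun ω => Y ω - ε
  have hZ : Measurable[hσ.measurableSpace] Z :=
    Measurable.piecewise (m := hσ.measurableSpace) hU.1 hYm (hYm.sub_const ε)
  have hYZ : Y ≤ᵐ[(Q : Measure (PathSpace d))] Z := by
    refine hY.least Z hZ fun R hR => ?_
    let B := {ω | Y ω - ε ≤ ((R : Measure (PathSpace d))[ξ | hσ.measurableSpace]) ω}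
    have hB : B ∈ C := ⟨(hYm.sub_const ε).stronglyMeasurable.measurableSet_le
      stronglyMeasurable_condExp, R, hR, ae_of_all _ fun _ h => h⟩
    have hUB : U ∪ B ∈ C := by
      have := hC (fun n => if n = 0 then U else B) fun n => by
        by_cases hn : n = 0
        · simpa [hn] using hU
        · simpa [hn] using hB
      convert this using 1
      ext ω
      simp only [Set.mem_union, Set.mem_iUnion]
      exact ⟨fun h => h.elim (fun h => ⟨0, by simpa using h⟩) fun h => ⟨1, by simpa using h⟩,
        fun ⟨n, hn⟩ => by by_cases h0 : n = 0 <;> simp [h0] at hn <;> tauto⟩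
    have h0 : (Q : Measure (PathSpace d)) ((U ∪ B) \ U) = 0 := by
      rw [measure_sdiff Set.subset_union_left (hle _ hU.1).nullMeasurableSet (measure_ne_top _ _)]
      exact tsub_eq_zero_of_le (hmax _ hUB)
    filter_upwards [hY.upper R hR, measure_eq_zero_iff_ae_notMem.1 h0] with ω h1 h2
    by_cases hω : ω ∈ U
    · simpa [Z, hω] using h1
    · simp only [Z, Set.piecewise_eq_of_notMem _ _ _ hω]
      refine (not_le.1 fun h3 => h2 ⟨Or.inr h3, hω⟩).le
  filter_upwards [hYZ, hPU] with ω h1 h2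
  refine h2 (by_contra fun hω => ?_)
  simp only [Z, Set.piecewise_eq_of_notMem _ _ _ hω] at h1
  linarith

/-- The dynamic programming inequality. The essential supremum at the later time may be replaced
on an event `D` of `𝓕_σ` only, keeping `ξ` itself outside: near-optimal priors are pasted on `D`
with `Q` outside `D`. -/
theorem IsEssSupCondExp.integrable_and_condExp_le {ρ : PathSpace d → ℝ≥0}
    {hρ : IsFiniteStoppingTime ρ} {hσ : IsFiniteStoppingTime σ} (hρσ : ∀ ω, ρ ω ≤ σ ω)
    {Q : ProbabilityMeasure (PathSpace d)} (hQ : Q ∈ 𝒬.priors) {ξ X Y : PathSpace d → ℝ}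
    (hξ : ∀ P ∈ 𝒬.priors, Integrable ξ (P : Measure (PathSpace d)))
    (hX : 𝒬.IsEssSupCondExp hρ Q ξ X) (hY : 𝒬.IsEssSupCondExp hσ Q ξ Y)
    {D : Set (PathSpace d)} (hD : MeasurableSet[hσ.measurableSpace] D) :
    Integrable (D.indicator Y + Dᶜ.indicator ξ) (Q : Measure (PathSpace d)) ∧
      (Q : Measure (PathSpace d))[D.indicator Y + Dᶜ.indicator ξ | hρ.measurableSpace]
        ≤ᵐ[(Q : Measure (PathSpace d))] X := by
  classical
  have hle := hσ.measurableSpace_le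
  have hmono : hρ.measurableSpace ≤ hσ.measurableSpace :=
    hρ.measurableSpace_mono hσ fun ω => WithTop.coe_le_coe.2 (hρσ ω)
  obtain ⟨y, hy, hYy⟩ := hY.aestronglyMeasurable
  have hy' : 𝒬.IsEssSupCondExp hσ Q ξ y :=
    ⟨hy.aestronglyMeasurable, fun R hR => (hY.upper R hR).trans hYy.le,
      fun Z hZ h => hYy.symm.le.trans (hY.least Z hZ h)⟩
  have hpaste : ∀ ε : ℝ, 0 < ε → ∃ P ∈ 𝒬.agreeing hσ Q,
      ∀ᵐ ω ∂(Q : Measure (PathSpace d)),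
        (ω ∈ D → y ω - ε ≤ ((P : Measure (PathSpace d))[ξ | hσ.measurableSpace]) ω) ∧
        (ω ∉ D → ((Q : Measure (PathSpace d))[ξ | hσ.measurableSpace]) ω =
          ((P : Measure (PathSpace d))[ξ | hσ.measurableSpace]) ω) := by
    intro ε hε
    obtain ⟨R, hR, hRy⟩ := hy'.exists_sub_le hQ hξ hy.measurable hε
    let N : PathSpace d → ℕ := D.piecewise (fun _ => 0) fun _ => 1
    have hN : Measurable[hσ.measurableSpace] N :=
      Measurable.piecewise (m := hσ.measurableSpace) hD measurable_const measurable_const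
    have hmem : ∀ n, (if n = 0 then R else Q) ∈ 𝒬.agreeing hσ Q := fun n => by
      by_cases hn : n = 0
      · simpa [hn] using hR
      · simpa [hn] using self_mem_agreeing hQ
    obtain ⟨P, hP, hPR⟩ := 𝒬.exists_agreeing_restrict_eq hσ hQ hmem hN
    refine ⟨P, hP, ?_⟩
    have heq := fun n => condExp_ae_eq_of_restrict_eq hle hP.2
      (hN (measurableSet_singleton n)) (hPR n) (hξ P hP.1) (hξ _ (hmem n).1)
    filter_upwards [heq 0, heq 1, hRy] with ω h0 h1 h2
    constructor
    · intro hω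
      rw [h0 (by simp [N, hω])]
      simpa using h2
    · intro hω
      rw [h1 (by simp [N, hω])]
      simp
  have hQm : StronglyMeasurable[hσ.measurableSpace]
    ((Q : Measure (PathSpace d))[ξ | hσ.measurableSpace]) := stronglyMeasurable_condExp
  have hDy : Integrable (D.indicator y) (Q : Measure (PathSpace d)) := by
    obtain ⟨P, hP, hPy⟩ := hpaste 1 one_pos
    have hZ : Integrable ((P : Measure (PathSpace d))[ξ | hσ.measurableSpace])
        (Q : Measure (PathSpace d)) :=
      integrable_of_agree hle hP.2 stronglyMeasurable_condExp integrable_condExp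
    refine integrable_of_le_of_le
      (g₁ := D.indicator ((Q : Measure (PathSpace d))[ξ | hσ.measurableSpace]))
      (g₂ := D.indicator ((P : Measure (PathSpace d))[ξ | hσ.measurableSpace] + fun _ => 1))
      ((hy.indicator hD).mono hle).aestronglyMeasurable ?_ ?_
      (integrable_condExp.indicator (hle _ hD))
      ((hZ.add (integrable_const _)).indicator (hle _ hD))
    · filter_upwards [hy'.upper Q (self_mem_agreeing hQ)] with ω h
      exact Set.indicator_le_indicator h
    · filter_upwards [hPy] with ω h
      by_cases hω : ω ∈ D
      · simp only [Set.indicator_of_mem hω, Pi.add_apply]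
        linarith [h.1 hω]
      · simp [hω]
  have hDξ : Integrable (Dᶜ.indicator ξ) (Q : Measure (PathSpace d)) :=
    (hξ Q hQ).indicator (hle _ hD.compl)
  have hUy : D.indicator Y + Dᶜ.indicator ξ =ᵐ[(Q : Measure (PathSpace d))]
      D.indicator y + Dᶜ.indicator ξ := by
    filter_upwards [hYy] with ω h
    simp only [Pi.add_apply, Set.indicator, h]
  refine ⟨(hDy.add hDξ).congr hUy.symm, ?_⟩
  -- the conditional expectation at the later time, computed on `D` and on its complement
  have hV : (Q : Measure (PathSpace d))[D.indicator y + Dᶜ.indicator ξ | hσ.measurableSpace]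
      =ᵐ[(Q : Measure (PathSpace d))] D.indicator y +
        Dᶜ.indicator ((Q : Measure (PathSpace d))[ξ | hσ.measurableSpace]) := by
    refine (condExp_add hDy hDξ _).trans ?_
    rw [condExp_of_stronglyMeasurable hle (hy.indicator hD) hDy]
    exact EventuallyEq.rfl.add (condExp_indicator (hξ Q hQ) hD.compl)
  have hstep : ∀ n : ℕ, ∀ᵐ ω ∂(Q : Measure (PathSpace d)),
      ((Q : Measure (PathSpace d))[D.indicator Y + Dᶜ.indicator ξ | hρ.measurableSpace]) ω ≤
        X ω + 1 / ((n : ℝ) + 1) := by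
    intro n
    have hε : (0 : ℝ) < 1 / ((n : ℝ) + 1) := by positivity
    obtain ⟨P, hP, hPy⟩ := hpaste _ hε
    have hPρ : P ∈ 𝒬.agreeing hρ Q := ⟨hP.1, fun A hA => hP.2 A (hmono A hA)⟩
    let Z := (P : Measure (PathSpace d))[ξ | hσ.measurableSpace]
    have hZm : StronglyMeasurable[hσ.measurableSpace] Z := stronglyMeasurable_condExp
    have hZ : Integrable Z (Q : Measure (PathSpace d)) :=
      integrable_of_agree hle hP.2 hZm integrable_condExp
    have h1 := condExp_congr_ae (m := hρ.measurableSpace) hUy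
    have h2 := condExp_condExp_of_le (μ := (Q : Measure (PathSpace d)))
      (f := D.indicator y + Dᶜ.indicator ξ) hmono hle
    have h3 : (Q : Measure (PathSpace d))[(Q : Measure (PathSpace d))[D.indicator y +
        Dᶜ.indicator ξ | hσ.measurableSpace] | hρ.measurableSpace] ≤ᵐ[(Q : Measure (PathSpace d))]
        (Q : Measure (PathSpace d))[Z + fun _ => 1 / ((n : ℝ) + 1) | hρ.measurableSpace] := by
      refine condExp_mono integrable_condExp (hZ.add (integrable_const _)) ?_
      filter_upwards [hV, hPy] with ω hω hω'
      rw [hω]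
      by_cases hωD : ω ∈ D
      · simp only [Pi.add_apply, Set.indicator_of_mem hωD, Z,
          Set.indicator_of_notMem (Set.notMem_compl_iff.2 hωD)]
        linarith [hω'.1 hωD]
      · simp only [Pi.add_apply, Set.indicator_of_notMem hωD, Z,
          Set.indicator_of_mem (Set.mem_compl hωD)]
        linarith [hω'.2 hωD]
    have h4 := condExp_add hZ
      (integrable_const (μ := (Q : Measure (PathSpace d))) (1 / ((n : ℝ) + 1))) hρ.measurableSpace
    have h5 := condExp_ae_eq_of_agree hle hmono hP.2 hZm integrable_condExp
    have h6 : (P : Measure (PathSpace d))[Z | hρ.measurableSpace] =ᵐ[(Q : Measure (PathSpace d))]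
        (P : Measure (PathSpace d))[ξ | hρ.measurableSpace] := by
      refine ae_of_ae_of_agree hPρ.2 ?_ (condExp_condExp_of_le hmono hle)
      exact stronglyMeasurable_condExp.measurableSet_eq_fun stronglyMeasurable_condExp
    rw [condExp_const hρ.measurableSpace_le] at h4
    filter_upwards [h1, h2, h3, h4, h5, h6, hX.upper P hPρ] with ω e1 e2 e3 e4 e5 e6 e7
    simp only [Pi.add_apply] at e4
    rw [e1, ← e2]
    refine e3.trans ?_
    rw [e4, ← e5, e6]
    linarith
  filter_upwards [ae_all_iff.2 hstep] with ω h
  have hlim : Tendsto (fun n : ℕ => X ω + 1 / ((n : ℝ) + 1)) atTop (𝓝 (X ω)) := by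
    simpa using tendsto_one_div_add_atTop_nhds_zero_nat.const_add (X ω)
  exact ge_of_tendsto' hlim h

end PriorFamily

/-! ### Stopped times -/

/-- The finite time `t ∧ x` for a possibly infinite `x`, in the form in which it occurs in a
stopped process. -/
def capTime (t : ℝ≥0) (x : WithTop ℝ≥0) : ℝ≥0 := (min (t : WithTop ℝ≥0) x).untopA

theorem coe_capTime (t : ℝ≥0) (x : WithTop ℝ≥0) :
    ((capTime t x : ℝ≥0) : WithTop ℝ≥0) = min (t : WithTop ℝ≥0) x := by
  induction x with
  | top => rw [capTime, min_eq_left le_top]; rfl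
  | coe x => rw [capTime, ← WithTop.coe_min]; rfl

theorem stoppedProcess_eq_capTime (X : ℝ≥0 → PathSpace d → ℝ) (T : PathSpace d → WithTop ℝ≥0)
    (t : ℝ≥0) (ω : PathSpace d) : stoppedProcess X T t ω = X (capTime t (T ω)) ω := rfl

theorem isFiniteStoppingTime_capTime {T : PathSpace d → WithTop ℝ≥0}
    (hT : IsStoppingTime (canonFiltration d) T) (t : ℝ≥0) :
    IsFiniteStoppingTime fun ω => capTime t (T ω) := by
  simp only [IsFiniteStoppingTime, coe_capTime]
  exact (isStoppingTime_const _ t).min hT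

/-- As `𝓕₀` is trivial, a stopping time is either positive everywhere or zero everywhere. -/
theorem bot_lt_eq_empty_or_univ {T : PathSpace d → WithTop ℝ≥0}
    (hT : IsStoppingTime (canonFiltration d) T) :
    {ω | ⊥ < T ω} = ∅ ∨ {ω | ⊥ < T ω} = Set.univ := by
  refine eq_empty_or_univ_of_measurableSet_zero ?_
  convert (hT 0).compl using 1
  ext ω
  have h0 : (⊥ : WithTop ℝ≥0) = ((0 : ℝ≥0) : WithTop ℝ≥0) := rfl
  simp only [h0, Set.mem_ofPred_eq, Set.mem_compl_iff, not_le]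

/-- On `{s ≤ T}` conditioning at time `s` is conditioning at the stopping time `s ∧ T`. -/
theorem condExp_capTime_ae_eq {T : PathSpace d → WithTop ℝ≥0}
    (hT : IsStoppingTime (canonFiltration d) T) (s : ℝ≥0) (Q : ProbabilityMeasure (PathSpace d))
    (f : PathSpace d → ℝ) :
    ∀ᵐ ω ∂(Q : Measure (PathSpace d)), (s : WithTop ℝ≥0) ≤ T ω →
      ((Q : Measure (PathSpace d))[f | (isFiniteStoppingTime_capTime hT s).measurableSpace]) ω =
        ((Q : Measure (PathSpace d))[f | canonFiltration d s]) ω := by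
  have aux : ∀ (U V : PathSpace d → WithTop ℝ≥0) (hU : IsStoppingTime (canonFiltration d) U)
      (hV : IsStoppingTime (canonFiltration d) V), U = V →
      hU.measurableSpace = hV.measurableSpace := by
    rintro U V hU hV rfl
    rfl
  have hs := isStoppingTime_const (canonFiltration d) s
  have h := condExp_min_stopping_time_ae_eq_restrict_le
    (μ := (Q : Measure (PathSpace d))) (f := f) hs hT
  rw [← aux _ _ (isFiniteStoppingTime_capTime hT s) (hs.min hT)
    (funext fun ω => coe_capTime s (T ω)), IsStoppingTime.measurableSpace_const] at h
  exact (ae_restrict_iff' (measurableSet_le measurable_const hT.measurable')).1 h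

/-- The indicator of an event of a sub-`σ`-algebra preserves measurability up to null sets with
respect to that sub-`σ`-algebra. -/
theorem aestronglyMeasurable_indicator {Ω : Type*} {m m₀ : MeasurableSpace Ω}
    {μ : Measure Ω} {f : Ω → ℝ} (hf : AEStronglyMeasurable[m] f μ) {s : Set Ω}
    (hs : MeasurableSet[m] s) : AEStronglyMeasurable[m] (s.indicator f) μ := by
  obtain ⟨g, hg, hfg⟩ := hf
  exact ⟨s.indicator g, hg.indicator hs, hfg.indicator⟩

/-! ### Integrability of the payoff and the bubble -/

namespace Market

variable {𝒬 : PriorFamily d} (M : Market 𝒬)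

theorem wealth_of_lt {t : ℝ≥0} {ω : PathSpace d} (h : (t : WithTop ℝ≥0) < M.τ ω) :
    M.wealth t ω = M.S t ω := if_pos h

theorem wealth_of_le {t : ℝ≥0} {ω : PathSpace d} (h : M.τ ω ≤ t) :
    M.wealth t ω = M.payoff ω := if_neg h.not_gt

theorem bubble_of_lt (Sstar : ℝ≥0 → PathSpace d → ℝ) {t : ℝ≥0} {ω : PathSpace d}
    (h : (t : WithTop ℝ≥0) < M.τ ω) : M.bubble Sstar t ω = M.S t ω - Sstar t ω := by
  simp only [bubble, fundamentalWealth, M.wealth_of_lt h, Set.indicator_apply, Set.mem_ofPred_eq,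
    if_neg h.not_ge, add_zero]

theorem bubble_of_le (Sstar : ℝ≥0 → PathSpace d → ℝ) {t : ℝ≥0} {ω : PathSpace d}
    (h : M.τ ω ≤ t) : M.bubble Sstar t ω = - Sstar t ω := by
  simp only [bubble, fundamentalWealth, M.wealth_of_le h, Set.indicator_apply, Set.mem_ofPred_eq,
    if_pos h]
  ring

theorem wealth_nonneg {Q : ProbabilityMeasure (PathSpace d)} (hQ : Q ∈ 𝒬.priors) :
    ∀ᵐ ω ∂(Q : Measure (PathSpace d)), ∀ t, 0 ≤ M.wealth t ω := by
  filter_upwards [M.nonneg Q hQ] with ω h t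
  simp only [wealth, wealthOf, payoffOf]
  split_ifs
  · exact h t
  · exact le_rfl
  · exact h _

/-- The payoff is integrable under every prior, by Fatou's lemma along a localizing sequence of
the nonnegative local martingale `W`, all of whose expectations equal that of `W₀`. -/
theorem integrable_payoff {Q : ProbabilityMeasure (PathSpace d)} (hQ : Q ∈ 𝒬.priors) :
    Integrable M.payoff (Q : Measure (PathSpace d)) := by
  obtain ⟨T, hT, hmart⟩ := M.wealth_localMartingale Q hQ
  -- from some index on the indicator of `{⊥ < T n}` in the localization is identically `1`
  obtain ⟨n₀, hn₀⟩ : ∃ n₀, ∀ n ≥ n₀, {ω | ⊥ < T n ω} = Set.univ := by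
    obtain ⟨ω, hω⟩ := hT.tendsto_top.exists
    obtain ⟨n₀, hn₀⟩ := eventually_atTop.1 (hω.eventually_const_lt (u := ⊥) bot_lt_top)
    refine ⟨n₀, fun n hn =>
      (bot_lt_eq_empty_or_univ (hT.isStoppingTime n)).resolve_left fun h => ?_⟩
    exact (Set.eq_empty_iff_forall_notMem.1 h ω) (hn₀ n hn)
  let f : ℕ → PathSpace d → ℝ := fun k ω =>
    M.wealth (capTime ((k + n₀ : ℕ) : ℝ≥0) (T (k + n₀) ω)) ω
  have hmart' : ∀ k, IsMartingaleUnder Q (stoppedProcess M.wealth (T (k + n₀))) := fun k => by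
    have h := hmart (k + n₀)
    rw [hn₀ _ (Nat.le_add_left _ _)] at h
    simp only [Set.indicator_univ] at h
    exact h
  have hfint : ∀ k, Integrable (f k) (Q : Measure (PathSpace d)) := fun k =>
    (hmart' k).integrable _
  have hf0 : ∀ k, 0 ≤ᵐ[(Q : Measure (PathSpace d))] f k := fun k => by
    filter_upwards [M.wealth_nonneg hQ] with ω h using h _
  have hfW : ∀ k, ∫ ω, f k ω ∂(Q : Measure (PathSpace d)) =
      ∫ ω, M.wealth 0 ω ∂(Q : Measure (PathSpace d)) := fun k => by
    have h := (hmart' k).condExp_eq 0 ((k + n₀ : ℕ) : ℝ≥0) bot_le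
    have h2 := integral_condExp (μ := (Q : Measure (PathSpace d))) ((canonFiltration d).le 0)
      (f := stoppedProcess M.wealth (T (k + n₀)) ((k + n₀ : ℕ) : ℝ≥0))
    refine h2.symm.trans ((integral_congr_ae h).trans (integral_congr_ae (ae_of_all _ fun ω => ?_)))
    have hc : capTime 0 (T (k + n₀) ω) = 0 := by
      rw [← WithTop.coe_inj, coe_capTime]
      exact min_eq_left bot_le
    simp only [stoppedProcess_eq_capTime, hc]
  -- restricting to the event of maturity makes the limit `0` where the asset never matures
  let g : ℕ → PathSpace d → ℝ := fun k =>
    {ω | M.τ ω ≤ ((k + n₀ : ℕ) : ℝ≥0)}.indicator (f k)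
  have hgm : ∀ k, AEStronglyMeasurable (g k) (Q : Measure (PathSpace d)) := fun k =>
    (hfint k).aestronglyMeasurable.indicator ((canonFiltration d).le _ _ (M.isStoppingTime _))
  have hlim : ∀ᵐ ω ∂(Q : Measure (PathSpace d)),
      Tendsto (fun k => g k ω) atTop (𝓝 (M.payoff ω)) := by
    filter_upwards [hT.tendsto_top] with ω hω
    by_cases hτ : M.τ ω = ⊤
    · refine tendsto_const_nhds.congr fun k => ?_
      simp [g, hτ, payoff, payoffOf]
    · have h1 : ∀ᶠ n in atTop, M.τ ω < T n ω :=
        hω.eventually_const_lt (lt_top_iff_ne_top.2 hτ)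
      obtain ⟨x, hx⟩ := WithTop.ne_top_iff_exists.1 hτ
      have h2 : ∀ᶠ n : ℕ in atTop, x ≤ (n : ℝ≥0) :=
        tendsto_natCast_atTop_atTop.eventually_ge_atTop x
      have h3 := (tendsto_add_atTop_nat n₀).eventually (h1.and h2)
      refine tendsto_const_nhds.congr' (h3.mono fun k hk => ?_)
      have hkx : M.τ ω ≤ ((k + n₀ : ℕ) : ℝ≥0) := by
        rw [← hx]
        exact WithTop.coe_le_coe.2 hk.2
      simp only [g, Set.indicator_of_mem (show ω ∈ {ω | M.τ ω ≤ ((k + n₀ : ℕ) : ℝ≥0)} from hkx), f]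
      refine (M.wealth_of_le ?_).symm
      rw [coe_capTime]
      exact le_min hkx hk.1.le
  refine ⟨aestronglyMeasurable_of_tendsto_ae atTop hgm hlim, ?_⟩
  calc ∫⁻ ω, ‖M.payoff ω‖ₑ ∂(Q : Measure (PathSpace d))
      = ∫⁻ ω, liminf (fun k => ‖g k ω‖ₑ) atTop ∂(Q : Measure (PathSpace d)) :=
        lintegral_congr_ae (hlim.mono fun ω h => h.enorm.liminf_eq.symm)
    _ ≤ liminf (fun k => ∫⁻ ω, ‖g k ω‖ₑ ∂(Q : Measure (PathSpace d))) atTop :=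
        lintegral_liminf_le' fun k => (hgm k).enorm
    _ ≤ ENNReal.ofReal (∫ ω, M.wealth 0 ω ∂(Q : Measure (PathSpace d))) := by
        refine liminf_le_of_le (by isBoundedDefault) fun b hb => ?_
        obtain ⟨k, hk⟩ := hb.exists
        refine hk.trans ?_
        rw [← hfW k, ofReal_integral_eq_lintegral_ofReal (hfint k) (hf0 k)]
        refine lintegral_mono_ae ?_
        filter_upwards [hf0 k] with ω h
        rw [← Real.enorm_of_nonneg h]
        exact enorm_indicator_le_enorm_self _ _
    _ < ⊤ := ENNReal.ofReal_lt_top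

/-- If the asset never matures under all priors that coincide with `Q` on `𝓕ₜ`, its fundamental
value at time `t` vanishes, so that the whole price is a bubble. -/
theorem hasRobustBubble_of_no_maturity {Sstar : ℝ≥0 → PathSpace d → ℝ}
    (hS : M.IsFundamentalValue Sstar) {Q : ProbabilityMeasure (PathSpace d)} (hQ : Q ∈ 𝒬.priors)
    (t : ℝ≥0)
    (hτ : ∀ Q' ∈ 𝒬.agreeing (isStoppingTime_const (canonFiltration d) t) Q,
      (Q' : Measure (PathSpace d)) {ω | M.τ ω = ⊤} = 1)
    (hpos : 0 < (Q : Measure (PathSpace d)) {ω | 0 < M.S t ω}) :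
    M.HasRobustBubble Sstar := by
  have hσ : IsFiniteStoppingTime fun _ : PathSpace d => t := isStoppingTime_const _ t
  have htop : MeasurableSet {ω | M.τ ω = ⊤} := M.isStoppingTime.measurableSet_eq_top
  have hae : ∀ Q' ∈ 𝒬.agreeing hσ Q, ∀ᵐ ω ∂(Q' : Measure (PathSpace d)), M.τ ω = ⊤ :=
    fun Q' hQ' => (mem_ae_iff_prob_eq_one htop).2 (hτ Q' hQ')
  obtain ⟨Y, hY, hSY⟩ := hS _ hσ Q hQ
  have hY0 : Y ≤ᵐ[(Q : Measure (PathSpace d))] 0 := by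
    refine hY.least 0 measurable_const fun Q' hQ' => ?_
    have h0 : M.payoff =ᵐ[(Q' : Measure (PathSpace d))] 0 := by
      filter_upwards [hae Q' hQ'] with ω h
      simp [payoff, payoffOf, h]
    have h1 : (Q' : Measure (PathSpace d))[M.payoff | hσ.measurableSpace]
        =ᵐ[(Q' : Measure (PathSpace d))] 0 := by
      simpa using condExp_congr_ae (m := hσ.measurableSpace) h0
    have h2 : (Q' : Measure (PathSpace d))[M.payoff | hσ.measurableSpace]
        =ᵐ[(Q : Measure (PathSpace d))] 0 :=
      ae_of_ae_of_agree hQ'.2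
        (stronglyMeasurable_condExp.measurableSet_eq_fun stronglyMeasurable_const) h1
    exact h2.le
  refine ⟨_, hσ, Q, hQ, hpos.trans_le (measure_mono_ae ?_)⟩
  filter_upwards [hae Q (PriorFamily.self_mem_agreeing hQ), hY0, hSY] with ω h1 h2 h3 hω
  have hlt : (t : WithTop ℝ≥0) < M.τ ω := by
    rw [h1]
    exact WithTop.coe_lt_top t
  have hω' : 0 < M.S t ω := hω
  have h2' : Y ω ≤ 0 := h2
  change 0 < M.bubble Sstar t ω
  simp only [Set.indicator_apply, Set.mem_ofPred_eq, if_pos hlt] at h3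
  rw [M.bubble_of_lt Sstar hlt, h3]
  linarith

/-- A stopped bubble is a submartingale if the correspondingly stopped wealth is a martingale. -/
theorem isSubmartingaleUnder_stoppedProcess_bubble {Sstar : ℝ≥0 → PathSpace d → ℝ}
    (hS : M.IsFundamentalValue Sstar) {Q : ProbabilityMeasure (PathSpace d)} (hQ : Q ∈ 𝒬.priors)
    {T : PathSpace d → WithTop ℝ≥0} (hT : IsStoppingTime (canonFiltration d) T)
    (hmart : IsMartingaleUnder Q (stoppedProcess M.wealth T)) :
    IsSubmartingaleUnder Q (stoppedProcess (M.bubble Sstar) T) := by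
  let σ : ℝ≥0 → PathSpace d → ℝ≥0 := fun t ω => capTime t (T ω)
  have hσ : ∀ t, IsFiniteStoppingTime (σ t) := fun t => isFiniteStoppingTime_capTime hT t
  have hσmono : ∀ {s t : ℝ≥0}, s ≤ t → ∀ ω, σ s ω ≤ σ t ω := fun {s t} hst ω => by
    rw [← WithTop.coe_le_coe, coe_capTime, coe_capTime]
    exact min_le_min_right _ (WithTop.coe_le_coe.2 hst)
  have hσle : ∀ t, (hσ t).measurableSpace ≤ canonFiltration d t := fun t =>
    IsStoppingTime.measurableSpace_le_of_le_const _ fun ω => by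
      rw [coe_capTime]
      exact min_le_left _ _
  have hξ : ∀ P ∈ 𝒬.priors, Integrable M.payoff (P : Measure (PathSpace d)) :=
    fun P hP => M.integrable_payoff hP
  choose Y hY hSY using fun t => hS (σ t) (hσ t) Q hQ
  let D : ℝ≥0 → Set (PathSpace d) := fun t => {ω | (σ t ω : WithTop ℝ≥0) < M.τ ω}
  have hD : ∀ t, MeasurableSet[(hσ t).measurableSpace] (D t) := fun t => by
    have h := (M.isStoppingTime.measurableSet_stopping_time_le (hσ t)).compl
    simpa only [Set.compl_ofPred, not_le] using h
  let N := stoppedProcess M.wealth T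
  let X := stoppedProcess (M.bubble Sstar) T
  let U : ℝ≥0 → PathSpace d → ℝ := fun t => (D t).indicator (Y t) + (D t)ᶜ.indicator M.payoff
  -- before maturity the bubble is `W - Y`; from maturity on it vanishes
  have hXD : ∀ t, X t =ᵐ[(Q : Measure (PathSpace d))] (D t).indicator (N t - Y t) := by
    intro t
    filter_upwards [hSY t] with ω h
    change M.bubble Sstar (σ t ω) ω = _
    by_cases hω : ω ∈ D t
    · have hω' : (σ t ω : WithTop ℝ≥0) < M.τ ω := hω
      simp only [Set.indicator_apply, Set.mem_ofPred_eq, if_pos hω'] at h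
      rw [Set.indicator_of_mem hω, M.bubble_of_lt Sstar hω', h, ← M.wealth_of_lt hω']
      rfl
    · have hω' : ¬ (σ t ω : WithTop ℝ≥0) < M.τ ω := hω
      simp only [Set.indicator_apply, Set.mem_ofPred_eq, if_neg hω'] at h
      rw [Set.indicator_of_notMem hω, M.bubble_of_le Sstar (not_lt.1 hω'), h, neg_zero]
  have hXU : ∀ t, X t =ᵐ[(Q : Measure (PathSpace d))] N t - U t := by
    intro t
    filter_upwards [hXD t] with ω h
    rw [h]
    by_cases hω : ω ∈ D t
    · simp [U, hω]
    · have hω' : ¬ (σ t ω : WithTop ℝ≥0) < M.τ ω := hω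
      have hN : N t ω = M.payoff ω := M.wealth_of_le (not_lt.1 hω')
      simp [U, hω, hN]
  have hU : ∀ s t, s ≤ t → Integrable (U t) (Q : Measure (PathSpace d)) ∧
      (Q : Measure (PathSpace d))[U t | (hσ s).measurableSpace]
        ≤ᵐ[(Q : Measure (PathSpace d))] Y s := fun s t hst =>
    PriorFamily.IsEssSupCondExp.integrable_and_condExp_le (hσmono hst) hQ hξ (hY s) (hY t) (hD t)
  have hXm : ∀ t, AEStronglyMeasurable[canonFiltration d t] (X t)
      (Q : Measure (PathSpace d)) := fun t =>
    (aestronglyMeasurable_indicator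
      ((hmart.adapted t).sub ((hY t).aestronglyMeasurable.mono (hσle t)))
      (hσle t _ (hD t))).congr (hXD t).symm
  have hXint : ∀ t, Integrable (X t) (Q : Measure (PathSpace d)) := fun t =>
    ((hmart.integrable t).sub (hU t t le_rfl).1).congr (hXU t).symm
  refine ⟨hXm, hXint, fun s t hst => ?_⟩
  have hle := (canonFiltration d).le s
  let E : Set (PathSpace d) := {ω | (s : WithTop ℝ≥0) ≤ T ω}
  have hE : MeasurableSet[canonFiltration d s] E := by
    have h := (hT.measurableSet_lt s).compl
    simpa only [Set.compl_ofPred, not_lt] using h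
  -- after `s` the stopped bubble moves only on `G`
  let G := D s ∩ E
  have hG : MeasurableSet[canonFiltration d s] G := (hσle s _ (hD s)).inter hE
  have hGc : Gᶜ.indicator (X t) =ᵐ[(Q : Measure (PathSpace d))] Gᶜ.indicator (X s) := by
    filter_upwards [hXD s, hXD t] with ω hs ht
    by_cases hω : ω ∈ G
    · simp [hω]
    rw [Set.indicator_of_mem (Set.mem_compl hω), Set.indicator_of_mem (Set.mem_compl hω)]
    by_cases hωE : ω ∈ E
    · have hωs : ω ∉ D s := fun h => hω ⟨h, hωE⟩
      have hωt : ω ∉ D t := fun h =>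
        hωs (lt_of_le_of_lt (WithTop.coe_le_coe.2 (hσmono hst ω)) h)
      rw [hs, ht, Set.indicator_of_notMem hωs, Set.indicator_of_notMem hωt]
    · have hTs : T ω < s := not_le.1 hωE
      have heq : capTime t (T ω) = capTime s (T ω) := by
        rw [← WithTop.coe_inj, coe_capTime, coe_capTime, min_eq_right hTs.le,
          min_eq_right (hTs.le.trans (WithTop.coe_le_coe.2 hst))]
      change M.bubble Sstar (capTime t (T ω)) ω = M.bubble Sstar (capTime s (T ω)) ω
      rw [heq]
  have h1 := condExp_indicator (hXint t) hG.compl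
  have h2 := condExp_congr_ae (m := canonFiltration d s) hGc
  have h3 := condExp_of_aestronglyMeasurable' hle (aestronglyMeasurable_indicator (hXm s) hG.compl)
    ((hXint s).indicator (hle _ hG.compl))
  have h4 := condExp_congr_ae (m := canonFiltration d s) (hXU t)
  have h5 := condExp_sub (hmart.integrable t) (hU s t hst).1 (canonFiltration d s)
  filter_upwards [h1, h2, h3, h4, h5, hmart.condExp_eq s t hst, (hU s t hst).2, hXD s,
    condExp_capTime_ae_eq hT s Q (U t)] with ω e1 e2 e3 e4 e5 e6 e7 e8 e9
  by_cases hω : ω ∈ G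
  · rw [Set.indicator_of_mem hω.1] at e8
    change X s ω ≤ _
    rw [e8, e4, e5, Pi.sub_apply, Pi.sub_apply, e6, ← e9 hω.2]
    exact sub_le_sub_left e7 _
  · rw [e2, e3, Set.indicator_of_mem (Set.mem_compl hω),
      Set.indicator_of_mem (Set.mem_compl hω)] at e1
    exact e1.le

theorem isLocalSubmartingaleUnder_bubble {Sstar : ℝ≥0 → PathSpace d → ℝ}
    (hS : M.IsFundamentalValue Sstar) {Q : ProbabilityMeasure (PathSpace d)}
    (hQ : Q ∈ 𝒬.priors) : IsLocalSubmartingaleUnder Q (M.bubble Sstar) := by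
  obtain ⟨T, hT, hmart⟩ := M.wealth_localMartingale Q hQ
  refine ⟨T, hT, fun n => ?_⟩
  have h := hmart n
  rcases bot_lt_eq_empty_or_univ (hT.isStoppingTime n) with h0 | h0
  · rw [h0]
    simp only [Set.indicator_empty]
    exact ⟨fun _ => aestronglyMeasurable_const, fun _ => integrable_const 0, fun s t _ => by
      simp only [stoppedProcess_const, condExp_const ((canonFiltration d).le s)]
      exact EventuallyLE.rfl⟩
  · rw [h0] at h ⊢
    simp only [Set.indicator_univ] at h ⊢
    exact M.isSubmartingaleUnder_stoppedProcess_bubble hS hQ (hT.isStoppingTime n) h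

end Market

/-! ### Fiat money -/

/-- The family of all deterministic models: every `𝒬(s, ω)` consists of all the point masses. -/
def diracPriorFamily (d : ℕ) : PriorFamily d where
  sets _ _ := Set.range diracProba
  nonanticipative _ _ _ _ := rfl
  analytic_graph τ _ := by
    have h : {p : ProbabilityMeasure (PathSpace d) × PathSpace d | p.1 ∈ Set.range diracProba} =
        Set.range fun q : PathSpace d × PathSpace d => (diracProba q.1, q.2) := by
      ext ⟨P, ω⟩
      simp
    rw [h]
    exact analyticSet_range_of_polishSpace
      ((continuous_diracProba.comp continuous_fst).prodMk continuous_snd)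
  invariance s ωbar τ hτ hs P hP := by
    obtain ⟨ω₀, rfl⟩ := hP
    -- under a point mass at `ω₀` the conditional law is constant; the kernel
    -- `ω ↦ diracProba (shift (θ ω) ω)` would look into the future
    refine ⟨fun _ => diracProba (shift (shiftedTime τ s ωbar ω₀) ω₀), ⟨fun B hB => ?_, ?_⟩, ?_⟩
    · exact measurable_const
    · intro A B hA hB
      have hθ := isFiniteStoppingTime_shiftedTime hτ s ωbar
      have hA' := hθ.measurableSpace_le _ hA
      have hB' := hθ.measurable_shift hB
      simp only [diracProba, ProbabilityMeasure.coe_mk]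
      have hAB := Measure.dirac_apply' ω₀ (hA'.inter hB')
      refine hAB.trans ?_
      rw [setLIntegral_const, Measure.dirac_apply' _ hB,
        Measure.dirac_apply' _ hA', mul_comm]
      by_cases h1 : ω₀ ∈ A <;> by_cases h2 : shift (shiftedTime τ s ωbar ω₀) ω₀ ∈ B <;>
        simp [h1, h2]
    · exact ae_of_all _ fun _ => ⟨_, rfl⟩
  pasting s ωbar τ hτ hs P hP ν hν hmem R hR := by
    obtain ⟨ω₀, rfl⟩ := hP
    simp only [diracProba, ProbabilityMeasure.coe_mk, ae_dirac_eq, lintegral_dirac] at hmem hR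
    obtain ⟨ω₁, hω₁⟩ : ν ω₀ ∈ Set.range diracProba := hmem
    refine ⟨concat (shiftedTime τ s ωbar ω₀) ω₀ ω₁, Subtype.ext (Measure.ext fun A hA => ?_)⟩
    have h := hR A hA
    rw [← hω₁] at h
    refine Eq.trans ?_ h.symm
    simp [diracProba, Set.indicator]

/-- The market of an asset with constant price `1` that never matures. -/
def fiatMarket (𝒬 : PriorFamily d) : Market 𝒬 where
  S _ _ := 1
  τ _ := ⊤
  adapted _ := measurable_const
  rightContinuous _ _ := continuousWithinAt_const
  continuous _ _ := ae_of_all _ fun _ => continuous_const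
  nonneg _ _ := ae_of_all _ fun _ _ => zero_le_one
  isStoppingTime t := by simp
  maturity_pos _ _ := ae_of_all _ fun _ => WithTop.coe_lt_top 0
  wealth_localMartingale Q _ := by
    have h : wealthOf (fun (_ : ℝ≥0) (_ : PathSpace d) => (1 : ℝ)) (fun _ => ⊤) =
        fun _ _ => 1 := by
      funext t ω
      exact if_pos (WithTop.coe_lt_top t)
    rw [h]
    exact Locally.of_prop ⟨fun _ => aestronglyMeasurable_const, fun _ => integrable_const 1,
      fun s t _ => by rw [condExp_const ((canonFiltration d).le s)]⟩

theorem wealth_fiatMarket (𝒬 : PriorFamily d) (t : ℝ≥0) (ω : PathSpace d) :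
    (fiatMarket 𝒬).wealth t ω = 1 := (fiatMarket 𝒬).wealth_of_lt (WithTop.coe_lt_top t)

theorem payoff_fiatMarket (𝒬 : PriorFamily d) : (fiatMarket 𝒬).payoff = fun _ => 0 :=
  by
  funext ω
  simp [Market.payoff, payoffOf, fiatMarket]

theorem PriorFamily.isEssSupCondExp_const (𝒬 : PriorFamily d) {σ : PathSpace d → ℝ≥0}
    (hσ : IsFiniteStoppingTime σ) {Q : ProbabilityMeasure (PathSpace d)} (hQ : Q ∈ 𝒬.priors)
    (c : ℝ) : 𝒬.IsEssSupCondExp hσ Q (fun _ => c) fun _ => c := by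
  refine ⟨aestronglyMeasurable_const, fun Q' _ => ?_, fun Z _ h => ?_⟩
  · rw [condExp_const hσ.measurableSpace_le]
  · have := h Q (self_mem_agreeing hQ)
    rwa [condExp_const hσ.measurableSpace_le] at this

theorem isRobustMartingale_const (𝒬 : PriorFamily d) (c : ℝ) :
    IsRobustMartingale 𝒬 fun _ _ => c where
  adapted _ := measurable_const
  integrable _ _ _ := integrable_const c
  bddAbove _ := ⟨c, by
    rintro _ ⟨Q, -, rfl⟩
    simp⟩
  condExp_eq _ _ _ _ hQ := 𝒬.isEssSupCondExp_const _ hQ c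

theorem isFundamentalValue_fiatMarket (𝒬 : PriorFamily d) :
    (fiatMarket 𝒬).IsFundamentalValue fun _ _ => 0 := by
  intro σ hσ Q hQ
  refine ⟨fun _ => 0, ?_, ae_of_all _ fun ω => by simp⟩
  rw [payoff_fiatMarket]
  exact 𝒬.isEssSupCondExp_const hσ hQ 0

end RobustBubbles

end

theorem mainTheorem9 :
    -- (i) no maturity under all priors that agree with `Qbar` up to time `t`: robust bubble
    (∀ (d : ℕ) (𝒬 : PriorFamily d) (M : Market 𝒬) (Sstar : ℝ≥0 → PathSpace d → ℝ),
      M.IsFundamentalValue Sstar →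
      ∀ Qbar ∈ 𝒬.priors, ∀ t : ℝ≥0,
        (∀ Q' ∈ 𝒬.agreeing (isStoppingTime_const (canonFiltration d) t) Qbar,
          (Q' : Measure (PathSpace d)) {ω | M.τ ω = ⊤} = 1) →
        0 < (Qbar : Measure (PathSpace d)) {ω | 0 < M.S t ω} →
        M.HasRobustBubble Sstar) ∧
    -- (ii) the bubble is a local submartingale under every prior
    (∀ (d : ℕ) (𝒬 : PriorFamily d) (M : Market 𝒬) (Sstar : ℝ≥0 → PathSpace d → ℝ),
      M.IsFundamentalValue Sstar →
      ∀ Q ∈ 𝒬.priors, IsLocalSubmartingaleUnder Q (M.bubble Sstar)) ∧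
    -- (iii) fiat money: symmetric martingale wealth in the presence of a bubble
    (∀ d : ℕ,
      (∃ 𝒬 : PriorFamily d, 𝒬.priors.Nonempty) ∧
      ∀ 𝒬 : PriorFamily d, 𝒬.priors.Nonempty →
        ∃ (M : Market 𝒬) (Sstar : ℝ≥0 → PathSpace d → ℝ),
          (∀ t ω, M.S t ω = 1) ∧ (∀ ω, M.τ ω = ⊤) ∧
          M.IsFundamentalValue Sstar ∧
          IsSymmetricMartingale 𝒬 M.wealth ∧
          M.HasRobustBubble Sstar) := by
  refine ⟨fun d 𝒬 M Sstar hS Q hQ t hτ hpos => M.hasRobustBubble_of_no_maturity hS hQ t hτ hpos,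
    fun d 𝒬 M Sstar hS Q hQ => M.isLocalSubmartingaleUnder_bubble hS hQ, fun d =>
    ⟨⟨diracPriorFamily d, diracProba ⟨0, rfl⟩, _, rfl⟩, fun 𝒬 ⟨Q, hQ⟩ => ?_⟩⟩
  refine ⟨fiatMarket 𝒬, fun _ _ => 0, fun _ _ => rfl, fun _ => rfl,
    isFundamentalValue_fiatMarket 𝒬, ⟨?_, ?_⟩, ?_⟩
  · simpa only [wealth_fiatMarket] using! isRobustMartingale_const 𝒬 1
  · simpa only [wealth_fiatMarket] using! isRobustMartingale_const 𝒬 (-1)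
  · refine (fiatMarket 𝒬).hasRobustBubble_of_no_maturity (isFundamentalValue_fiatMarket 𝒬) hQ 0
      (fun Q' _ => ?_) ?_
    · simp [fiatMarket]
    · simp [fiatMarket]
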